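/- **Conventions.** A *graph* $\Gamma$ is a finite multigraph without loops, with vertex set $\mathcal V$ and edge set $\mathcal E$; an *orientation* names one endpoint of each edge $e$ the left vertex $l(e)$ and the other the right vertex $r(e)$. A *$\Gamma$-field* $F_\bullet$ consists of a field $F_v$ for each $v\in\mathcal V$, a field $F_e$ for each $e\in\mathcal E$, and an injection $\iota_v^e:F_v\hookrightarrow F_e$ whenever $v$ is a vertex of $e$. Its inverse limit is the ring $F_\Gamma=\{(a_v)\in\prod_v F_v : \iota_v^e a_v=\iota_w^e a_w \text{ whenever } e \text{ is incident to } v \text{ and } w\}$. If $\Gamma$ is connected and $F$ is a field, $F_\bullet$ is a *$\Gamma/F$-field* if $F_\Gamma=F$; then all $F_v,F_e$ are $F$-algebras and all $\iota_v^e$ are $F$-algebra maps. Let $F^{\mathrm{sep}}$ be a separable closure of $F$. A *linear algebraic group* over $F$ is a smooth closed subgroup scheme $A\subseteq \mathrm{GL}_{n,F}$ for some $n$. Given an orientation of $\Gamma$, a closed subgroup scheme $A$ of some $\mathrm{GL}_{n,F}$ is *factorizable* over $F_\bullet$ if the map $\prod_{v} A(F_v)\to\prod_{e}A(F_e)$,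 $(a_v)_v\mapsto (a_{l(e)}a_{r(e)}^{-1})_e$, is surjective, and *separably factorizable* over $F_\bullet$ if the analogous map $\prod_v A(F_v\otimes_F F^{\mathrm{sep}})\to\prod_e A(F_e\otimes_F F^{\mathrm{sep}})$ is surjective. (These notions do not depend on the orientation.) A *vector space patching problem* over $F_\bullet$ consists of finite-dimensional vector spaces $V_v$ over $F_v$ and $V_e$ over $F_e$ for all $v\in\mathcal V$, $e\in\mathcal E$, with isomorphisms $V_v\otimes_{F_v}F_e\cong V_e$ of $F_e$-vector spaces whenever $v$ is a vertex of $e$; morphisms are families of linear maps at all vertices and edges compatible with these isomorphisms. *Patching holds for finite-dimensional vector spaces* over $F_\bullet$ if the base change functor $W\mapsto (W\otimes_F F_v, W\otimes_F F_e)_{v,e}$ from finite-dimensional $F$-vector spaces to vector space patching problems is an equivalence of categories. **Theorem.** Let $\Gamma$ be a connected graph, $F$ a field, and $F_\bullet$ a $\Gamma/F$-field. Then the following conditions are equivalent: 1. $\mathrm{GL}_n$ is factorizable over $F_\bullet$ for all $n\ge 1$; 2. $\mathrm{GL}_n$ is separably factorizable over $F_\bullet$ for all $n\ge 1$; 3.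 every linear algebraic group over $F$ is separably factorizable over $F_\bullet$. Moreover, patching holds for finite-dimensional vector spaces over $F_\bullet$ if and only if every linear algebraic group over $F$ is separably factorizable over $F_\bullet$. -/

import Mathlib

open CategoryTheory
open scoped TensorProduct

universe u w₁ w₂

noncomputable section

/-! ### Graphs -/

/-- A multigraph without loops, with vertex set `V` and edge set `E`: several edges may have the
same pair of endpoints, but the two endpoints of an edge are distinct. (Finiteness is expressed by
`[Finite V] [Finite E]`.) -/
structure LooplessMultigraph (V : Type w₁) (E : Type w₂) where
  /-- the unordered pair of endpoints of an edge -/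
  ends : E → Sym2 V
  not_isDiag : ∀ e, ¬ (ends e).IsDiag

namespace LooplessMultigraph

variable {V : Type w₁} {E : Type w₂}

/-- The simple graph on the vertices in which two vertices are adjacent if they are the endpoints
of some edge. -/
def toSimpleGraph (Γ : LooplessMultigraph V E) : SimpleGraph V where
  Adj v w := ∃ e, Γ.ends e = s(v, w)
  symm := ⟨fun _ _ ⟨e, he⟩ => ⟨e, he.trans Sym2.eq_swap⟩⟩
  loopless := ⟨fun _ ⟨e, he⟩ => Γ.not_isDiag e (he ▸ Sym2.mk_isDiag_iff.mpr rfl)⟩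

/-- A graph is connected if it is nonempty and any two vertices are joined by a path. -/
def Connected (Γ : LooplessMultigraph V E) : Prop := Γ.toSimpleGraph.Connected

/-- An orientation labels, for each edge, one of its endpoints as the left vertex and the other one
as the right vertex. -/
structure Orientation (Γ : LooplessMultigraph V E) where
  left : E → V
  right : E → V
  ends_eq : ∀ e, Γ.ends e = s(left e, right e)

namespace Orientation

variable {Γ : LooplessMultigraph V E} (o : Γ.Orientation) (e : E)

lemma left_mem : o.left e ∈ Γ.ends e := by
  rw [o.ends_eq]; exact Sym2.mem_mk_left _ _

lemma right_mem : o.right e ∈ Γ.ends e := by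
  rw [o.ends_eq]; exact Sym2.mem_mk_right _ _

end Orientation

end LooplessMultigraph

/-! ### `Γ`-fields -/

/-- A `Γ`-field: a field for every vertex, a field for every edge, and an injection
`ι : F_v → F_e` whenever `v` is a vertex of `e` (ring homomorphisms of fields are injective). -/
structure GammaField {V : Type w₁} {E : Type w₂} (Γ : LooplessMultigraph V E) where
  vfield : V → Type u
  efield : E → Type u
  [vfieldInst : ∀ v, Field (vfield v)]
  [efieldInst : ∀ e, Field (efield e)]
  ι : ∀ {v : V} {e : E}, v ∈ Γ.ends e → vfield v →+* efield e

attribute [instance] GammaField.vfieldInst GammaField.efieldInst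

/-- The inverse limit `F_Γ` of a `Γ`-field, as a subring of the product of the `F_v`. -/
def GammaField.inverseLimit {V : Type w₁} {E : Type w₂} {Γ : LooplessMultigraph V E}
    (K : GammaField.{u} Γ) : Subring (∀ v, K.vfield v) where
  carrier := {a | ∀ (e : E) (v w : V) (hv : v ∈ Γ.ends e) (hw : w ∈ Γ.ends e),
    K.ι hv (a v) = K.ι hw (a w)}
  mul_mem' ha hb e v w hv hw := by simp [ha e v w hv hw, hb e v w hv hw]
  one_mem' e v w hv hw := by simp
  add_mem' ha hb e v w hv hw := by simp [ha e v w hv hw, hb e v w hv hw]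
  zero_mem' e v w hv hw := by simp
  neg_mem' ha e v w hv hw := by simp [ha e v w hv hw]

/-- A `Γ`-field `F_•` together with an identification `F = F_Γ`: all the fields are `F`-algebras,
all the maps `ι` are `F`-algebra homomorphisms, and the diagonal map from `F` to the product of the
`F_v` is a bijection onto the inverse limit `F_Γ`. -/
structure GammaOverField {V : Type w₁} {E : Type w₂} (Γ : LooplessMultigraph V E)
    (F : Type u) [Field F] extends GammaField.{u} Γ where
  [valgebra : ∀ v, Algebra F (vfield v)]
  [ealgebra : ∀ e, Algebra F (efield e)]
  ι_comp_algebraMap : ∀ {v : V} {e : E} (h : v ∈ Γ.ends e),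
    (ι h).comp (algebraMap F (vfield v)) = algebraMap F (efield e)
  bijOn_inverseLimit : Set.BijOn (fun (x : F) (v : V) => algebraMap F (vfield v) x) Set.univ
    (toGammaField.inverseLimit : Set (∀ v, vfield v))

attribute [instance] GammaOverField.valgebra GammaOverField.ealgebra

namespace GammaOverField

variable {V : Type w₁} {E : Type w₂} {Γ : LooplessMultigraph V E} {F : Type u} [Field F]

/-- The map `ι : F_v → F_e` as a homomorphism of `F`-algebras. -/
def ιAlg (K : GammaOverField Γ F) {v : V} {e : E} (h : v ∈ Γ.ends e) :
    K.vfield v →ₐ[F] K.efield e where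
  toRingHom := K.ι h
  commutes' x := DFunLike.congr_fun (K.ι_comp_algebraMap h) x

/-- The map `F_v ⊗_F F^sep → F_e ⊗_F F^sep` induced by `ι`. -/
def ιSep (K : GammaOverField Γ F) {v : V} {e : E} (h : v ∈ Γ.ends e) :
    K.vfield v ⊗[F] SeparableClosure F →ₐ[F] K.efield e ⊗[F] SeparableClosure F :=
  Algebra.TensorProduct.map (K.ιAlg h) (AlgHom.id F (SeparableClosure F))

end GammaOverField

/-! ### Closed subgroup schemes of `GL_n` -/

/-- The coordinate ring `F[x_ij][1 / det]` of `GL_n` over `F`. -/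
abbrev GLCoordRing (n : ℕ) (F : Type u) [Field F] : Type u :=
  Localization.Away (Matrix.mvPolynomialX (Fin n) (Fin n) F).det

lemma isUnit_aeval_det {n : ℕ} {F : Type u} [Field F] {S : Type u} [CommRing S] [Algebra F S]
    (g : GL (Fin n) S) :
    IsUnit (MvPolynomial.aeval (fun p : Fin n × Fin n => (g : Matrix (Fin n) (Fin n) S) p.1 p.2)
      (Matrix.mvPolynomialX (Fin n) (Fin n) F).det) := by
  rw [AlgHom.map_det, Matrix.mvPolynomialX_mapMatrix_aeval]
  exact g.isUnit.map Matrix.detMonoidHom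

/-- Evaluation of regular functions on `GL_n` at a point `g ∈ GL_n(S)`, i.e. the `F`-algebra
homomorphism `F[x_ij][1 / det] → S` with `x_ij ↦ g_ij`. -/
def evalGL {n : ℕ} {F : Type u} [Field F] {S : Type u} [CommRing S] [Algebra F S]
    (g : GL (Fin n) S) : GLCoordRing n F →ₐ[F] S :=
  IsLocalization.Away.liftAlgHom (Matrix.mvPolynomialX (Fin n) (Fin n) F).det (isUnit_aeval_det g)

/-- A closed subgroup scheme of `GL_{n,F}`: a closed subscheme, given by an ideal of the coordinate
ring, whose `S`-points form a subgroup of `GL_n(S)` for every commutative `F`-algebra `S`. -/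
structure ClosedSubgroupGL (n : ℕ) (F : Type u) [Field F] where
  ideal : Ideal (GLCoordRing n F)
  one_mem : ∀ (S : Type u) [CommRing S] [Algebra F S], ∀ f ∈ ideal, evalGL (1 : GL (Fin n) S) f = 0
  mul_mem : ∀ (S : Type u) [CommRing S] [Algebra F S] (g h : GL (Fin n) S),
    (∀ f ∈ ideal, evalGL g f = 0) → (∀ f ∈ ideal, evalGL h f = 0) →
      ∀ f ∈ ideal, evalGL (g * h) f = 0
  inv_mem : ∀ (S : Type u) [CommRing S] [Algebra F S] (g : GL (Fin n) S),
    (∀ f ∈ ideal, evalGL g f = 0) → ∀ f ∈ ideal, evalGL g⁻¹ f = 0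

lemma evalGL_map {n : ℕ} {F : Type u} [Field F] {S T : Type u} [CommRing S] [Algebra F S]
    [CommRing T] [Algebra F T] (φ : S →ₐ[F] T) (g : GL (Fin n) S) (f : GLCoordRing n F) :
    evalGL (Matrix.GeneralLinearGroup.map (φ : S →+* T) g) f = φ (evalGL g f) := by
  have h : (evalGL (Matrix.GeneralLinearGroup.map (φ : S →+* T) g) : GLCoordRing n F →ₐ[F] T) =
      φ.comp (evalGL g) := by
    apply AlgHom.coe_ringHom_injective
    apply IsLocalization.ringHom_ext
      (Submonoid.powers (Matrix.mvPolynomialX (Fin n) (Fin n) F).det)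
    apply MvPolynomial.ringHom_ext
    · intro r
      simp [evalGL]
    · intro p
      simp [evalGL]
  exact DFunLike.congr_fun h f

namespace ClosedSubgroupGL

variable {n : ℕ} {F : Type u} [Field F]

/-- The group `A(S)` of `S`-points, for a commutative `F`-algebra `S`. -/
def points (A : ClosedSubgroupGL n F) (S : Type u) [CommRing S] [Algebra F S] :
    Subgroup (GL (Fin n) S) where
  carrier := {g | ∀ f ∈ A.ideal, evalGL g f = 0}
  one_mem' := A.one_mem S
  mul_mem' := A.mul_mem S _ _
  inv_mem' := A.inv_mem S _

/-- The homomorphism `A(S) → A(T)` induced by a homomorphism of `F`-algebras `S → T`. -/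
def pointsMap (A : ClosedSubgroupGL n F) {S T : Type u} [CommRing S] [Algebra F S]
    [CommRing T] [Algebra F T] (φ : S →ₐ[F] T) : A.points S →* A.points T :=
  ((Matrix.GeneralLinearGroup.map (φ : S →+* T)).comp (A.points S).subtype).codRestrict
    (A.points T) fun g f hf =>
      (evalGL_map φ (g : GL (Fin n) S) f).trans (by rw [g.2 f hf, map_zero])

/-- The group scheme `A` is smooth over `F`. A smooth closed subgroup scheme of some `GL_{n,F}` is
what is called a linear algebraic group over `F`. -/
def IsSmooth (A : ClosedSubgroupGL n F) : Prop :=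
  Algebra.Smooth F (GLCoordRing n F ⧸ A.ideal)

variable (n F) in
/-- `GL_n` itself, as the closed subgroup scheme given by the zero ideal. -/
def GLn : ClosedSubgroupGL n F where
  ideal := ⊥
  one_mem S _ _ f hf := by rw [Ideal.mem_bot.mp hf, map_zero]
  mul_mem S _ _ g h _ _ f hf := by rw [Ideal.mem_bot.mp hf, map_zero]
  inv_mem S _ _ g _ f hf := by rw [Ideal.mem_bot.mp hf, map_zero]

/-- The points of `GL_n` are all invertible matrices. -/
lemma points_GLn (S : Type u) [CommRing S] [Algebra F S] : (GLn n F).points S = ⊤ :=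
  top_unique fun g _ f hf => by rw [Ideal.mem_bot.mp hf, map_zero]

section Factorization

variable {V : Type w₁} {E : Type w₂} {Γ : LooplessMultigraph V E}

/-- The map `π_l · π_r⁻¹ : ∏_v A(F_v) → ∏_e A(F_e)`. -/
def factorMap (A : ClosedSubgroupGL n F) (K : GammaOverField Γ F) (o : Γ.Orientation)
    (a : ∀ v, A.points (K.vfield v)) (e : E) : A.points (K.efield e) :=
  A.pointsMap (K.ιAlg (o.left_mem e)) (a (o.left e)) *
    (A.pointsMap (K.ιAlg (o.right_mem e)) (a (o.right e)))⁻¹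

/-- `A` is factorizable over `F_•` (with respect to an orientation of the graph). -/
def IsFactorizable (A : ClosedSubgroupGL n F) (K : GammaOverField Γ F) (o : Γ.Orientation) :
    Prop :=
  Function.Surjective (A.factorMap K o)

/-- The map `π_l · π_r⁻¹ : ∏_v A(F_v ⊗_F F^sep) → ∏_e A(F_e ⊗_F F^sep)`. -/
def sepFactorMap (A : ClosedSubgroupGL n F) (K : GammaOverField Γ F) (o : Γ.Orientation)
    (a : ∀ v, A.points (K.vfield v ⊗[F] SeparableClosure F)) (e : E) :
    A.points (K.efield e ⊗[F] SeparableClosure F) :=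
  A.pointsMap (K.ιSep (o.left_mem e)) (a (o.left e)) *
    (A.pointsMap (K.ιSep (o.right_mem e)) (a (o.right e)))⁻¹

/-- `A` is separably factorizable over `F_•` (with respect to an orientation of the graph). -/
def IsSepFactorizable (A : ClosedSubgroupGL n F) (K : GammaOverField Γ F) (o : Γ.Orientation) :
    Prop :=
  Function.Surjective (A.sepFactorMap K o)

end Factorization

end ClosedSubgroupGL

/-! ### Patching problems for vector spaces -/

section Patching

variable {V : Type w₁} {E : Type w₂} {Γ : LooplessMultigraph V E}

/-- A semilinear map `φ : M → N` along a ring homomorphism `f : R → S` exhibits `N` as the base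
change of `M`: the induced `S`-linear map `S ⊗_R M → N`, `s ⊗ m ↦ s • φ m`, is an isomorphism. -/
def IsBaseChangeAlong {R S : Type*} [CommRing R] [CommRing S] (f : R →+* S) {M N : Type*}
    [AddCommGroup M] [Module R M] [AddCommGroup N] [Module S N] (φ : M →ₛₗ[f] N) : Prop :=
  letI : Algebra R S := f.toAlgebra
  letI : Module R N := Module.compHom N f
  haveI : IsScalarTower R S N := ⟨fun r s n => mul_smul (f r) s n⟩
  IsBaseChange S ({ toFun := φ, map_add' := φ.map_add, map_smul' := φ.map_smulₛₗ } : M →ₗ[R] N)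

/-- A vector space patching problem over a `Γ`-field: finite-dimensional vector spaces `W_v` over
`F_v` and `U_e` over `F_e`, with an isomorphism `F_e ⊗_{F_v} W_v ≅ U_e` of `F_e`-vector spaces
whenever `v` is a vertex of `e`. This isomorphism is encoded by the corresponding transition map
`W_v → U_e`, which is semilinear along `F_v → F_e`. -/
structure PatchingProblem (K : GammaField.{u} Γ) where
  vspace : V → Type u
  espace : E → Type u
  [vaddCommGroup : ∀ v, AddCommGroup (vspace v)]
  [eaddCommGroup : ∀ e, AddCommGroup (espace e)]
  [vmodule : ∀ v, Module (K.vfield v) (vspace v)]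
  [emodule : ∀ e, Module (K.efield e) (espace e)]
  [vfinite : ∀ v, FiniteDimensional (K.vfield v) (vspace v)]
  [efinite : ∀ e, FiniteDimensional (K.efield e) (espace e)]
  φ : ∀ {v : V} {e : E} (h : v ∈ Γ.ends e), vspace v →ₛₗ[K.ι h] espace e
  isBaseChange : ∀ {v : V} {e : E} (h : v ∈ Γ.ends e), IsBaseChangeAlong (K.ι h) (φ h)

namespace PatchingProblem

attribute [instance] vaddCommGroup eaddCommGroup vmodule emodule vfinite efinite

/-- A morphism of patching problems: linear maps at all vertices and edges that are compatible with
the transition maps. -/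
@[ext]
structure Hom {K : GammaField.{u} Γ} (P Q : PatchingProblem K) where
  vhom : ∀ v, P.vspace v →ₗ[K.vfield v] Q.vspace v
  ehom : ∀ e, P.espace e →ₗ[K.efield e] Q.espace e
  comm : ∀ {v : V} {e : E} (h : v ∈ Γ.ends e) (x : P.vspace v),
    Q.φ h (vhom v x) = ehom e (P.φ h x)

instance (K : GammaField.{u} Γ) : Category (PatchingProblem K) where
  Hom := Hom
  id P := ⟨fun _ => LinearMap.id, fun _ => LinearMap.id, fun _ _ => rfl⟩
  comp f g := ⟨fun v => (g.vhom v).comp (f.vhom v), fun e => (g.ehom e).comp (f.ehom e),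
    fun h x => by simp [g.comm, f.comm]⟩
  id_comp _ := rfl
  comp_id _ := rfl
  assoc _ _ _ := rfl

end PatchingProblem

variable {F : Type u} [Field F]

/-- The canonical map `F_v ⊗_F W → F_e ⊗_F W`, `a ⊗ x ↦ ι a ⊗ x`, for an `F`-vector space `W`. -/
def GammaOverField.transition (K : GammaOverField Γ F) (W : Type u) [AddCommGroup W] [Module F W]
    {v : V} {e : E} (h : v ∈ Γ.ends e) : K.vfield v ⊗[F] W →ₛₗ[K.ι h] K.efield e ⊗[F] W where
  toFun := TensorProduct.map (K.ιAlg h).toLinearMap LinearMap.id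
  map_add' := map_add _
  map_smul' a x := by
    induction x with
    | zero => simp
    | add x y hx hy => simp only [smul_add, map_add, hx, hy]
    | tmul b w =>
      simp only [TensorProduct.smul_tmul', TensorProduct.map_tmul, smul_eq_mul,
        AlgHom.toLinearMap_apply, map_mul]
      rfl

lemma isBaseChangeAlong_of_comp {R S T : Type*} [CommRing R] [CommRing S] [CommRing T]
    [Algebra R S] [Algebra R T] (f : S →+* T) (hf : f.comp (algebraMap R S) = algebraMap R T)
    {M N P : Type*} [AddCommGroup M] [Module R M] [AddCommGroup N] [Module R N] [Module S N]
    [IsScalarTower R S N] [AddCommGroup P] [Module R P] [Module T P] [IsScalarTower R T P]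
    {i : M →ₗ[R] N} (hi : IsBaseChange S i) (φ : N →ₛₗ[f] P) {k : M →ₗ[R] P}
    (hk : IsBaseChange T k) (h : ∀ x, φ (i x) = k x) : IsBaseChangeAlong f φ := by
  let : Algebra S T := f.toAlgebra
  let : Module S P := Module.compHom P f
  have : IsScalarTower R S T := IsScalarTower.of_algebraMap_eq' hf.symm
  have : IsScalarTower S T P := ⟨fun r s n => mul_smul (f r) s n⟩
  have : IsScalarTower R S P := IsScalarTower.of_algebraMap_smul fun r n => by
    change f (algebraMap R S r) • n = r • n
    rw [← RingHom.comp_apply, hf, algebraMap_smul]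
  refine IsBaseChange.of_comp (f := i) hi ?_
  convert hk using 1
  ext w
  exact h w

lemma GammaOverField.isBaseChangeAlong_transition (K : GammaOverField Γ F) (W : Type u)
    [AddCommGroup W] [Module F W] {v : V} {e : E} (h : v ∈ Γ.ends e) :
    IsBaseChangeAlong (K.ι h) (K.transition W h) :=
  isBaseChangeAlong_of_comp (K.ι h) (K.ι_comp_algebraMap h)
    (TensorProduct.isBaseChange F W (K.vfield v)) (K.transition W h)
    (TensorProduct.isBaseChange F W (K.efield e)) fun w => by simp [transition]

lemma GammaOverField.transition_naturality (K : GammaOverField Γ F) {W W' : Type u}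
    [AddCommGroup W] [Module F W] [AddCommGroup W'] [Module F W'] (f : W →ₗ[F] W')
    {v : V} {e : E} (h : v ∈ Γ.ends e) (x : K.vfield v ⊗[F] W) :
    K.transition W' h (f.baseChange (K.vfield v) x) =
      f.baseChange (K.efield e) (K.transition W h x) := by
  induction x with
  | zero => simp
  | add x y hx hy => simp only [map_add, hx, hy]
  | tmul b w => simp [transition]

/-- The base change functor from finite-dimensional `F`-vector spaces to patching problems, sending
`W` to the system of all `F_v ⊗_F W` and `F_e ⊗_F W` with the canonical transition maps. -/
def baseChange (K : GammaOverField Γ F) : FGModuleCat.{u} F ⥤ PatchingProblem K.toGammaField where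
  obj W :=
    { vspace v := K.vfield v ⊗[F] W
      espace e := K.efield e ⊗[F] W
      φ h := K.transition W h
      isBaseChange h := K.isBaseChangeAlong_transition W h }
  map f :=
    { vhom v := f.hom.hom.baseChange (K.vfield v)
      ehom e := f.hom.hom.baseChange (K.efield e)
      comm h x := K.transition_naturality f.hom.hom h x }
  map_id W := PatchingProblem.Hom.ext
    (funext fun _ => LinearMap.baseChange_id) (funext fun _ => LinearMap.baseChange_id)
  map_comp f g := PatchingProblem.Hom.ext
    (funext fun _ => LinearMap.baseChange_comp _ _) (funext fun _ => LinearMap.baseChange_comp _ _)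

/-- Patching holds for finite-dimensional vector spaces over `F_•`: the base change functor is an
equivalence of categories. -/
def PatchingHolds (K : GammaOverField Γ F) : Prop := (baseChange K).IsEquivalence

end Patching

end

/-! Factoring matrices means gluing free modules. A family `g e` defines the space `W` of vertex
families `x` with `x_l = g x_r`, and a factorization `h_l = g h_r` says that the columns of `h` form
a basis of `W` which stays a basis at every vertex.

Passing to a finite extension is restriction of scalars: a rank `n` problem over `L` is a rank `n [L
: F]` problem over `F`. Its `F`-solution space has the right dimension, so `W` has dimension `n`
over `L`. Since there are finitely many edges, algebraic extensions reduce to finite ones.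
Conversely, a factorization over `L` descends because the coordinates of its columns in an `F`-basis
of `L` are solutions over `F`.

For a smooth group `A` and `g e ∈ A`, factor in `GL_n`: `h_l = g h_r`. The cosets `A h_v` then agree
at the edges. They are cut out by right translates of a finite-dimensional space of equations of
`A`, on which `A` acts by invertible matrices. Factoring those matrices glues the equations over
`F^sep`. The resulting scheme becomes a translate of `A` after a faithfully flat base change, so it
is smooth and nonempty and has a point `x` over `F^sep`; then `h_v x⁻¹` factors `g` in `A`
(`ClosedSubgroupGL.exists_factorization_of_glFactors`).

As `F = F_Γ`, base change of vector spaces is always fully faithful. Its essential surjectivity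
amounts to factorization for all `GL_n`, by choosing bases. -/

/-! ### Rational points of smooth algebras. -/

theorem IsSepClosed.infinite (k : Type*) [Field k] [IsSepClosed k] : Infinite k := by
  by_contra h
  have : Finite k := not_infinite_iff_finite.mp h
  have : IsAlgClosed k := inferInstance
  exact h inferInstance

/-- A nonzero smooth algebra over a separably closed field has a rational point. -/
theorem Algebra.Smooth.nonempty_algHom_of_isSepClosed (k : Type u) [Field k] [IsSepClosed k]
    (B : Type u) [CommRing B] [Algebra k B] [Nontrivial B] [Algebra.Smooth k B] :
    Nonempty (B →ₐ[k] k) := by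
  have := IsSepClosed.infinite k
  obtain ⟨p, hp⟩ := Ideal.exists_maximal B
  have : Algebra.IsSmoothAt k p := by
    have : (⟨p, hp.isPrime⟩ : PrimeSpectrum B) ∈ Algebra.smoothLocus k B := by
      rw [Algebra.smoothLocus_eq_univ]; trivial
    exact this
  -- Near `p` the algebra is étale over an affine space, and this map is open because it is flat of
  -- finite presentation.
  obtain ⟨f, hfp, n, _, _, _⟩ :=
    Algebra.IsSmoothAt.exists_isStandardEtale_mvPolynomial (R := k) (S := B) (p := p)
  set T := Localization.Away f
  have : Nontrivial T := by
    refine ⟨1, 0, fun h => hfp ?_⟩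
    rw [← map_one (algebraMap B T), ← map_zero (algebraMap B T),
      IsLocalization.eq_iff_exists (Submonoid.powers f)] at h
    obtain ⟨⟨_, m, rfl⟩, hc⟩ := h
    exact hp.isPrime.mem_of_pow_mem m (by simp_all)
  have hopen := PrimeSpectrum.isOpenMap_comap_of_hasGoingDown_of_finitePresentation
    (R := MvPolynomial (Fin n) k) (S := T)
  obtain ⟨y⟩ : Nonempty (PrimeSpectrum T) := inferInstance
  obtain ⟨_, ⟨_, ⟨h, rfl⟩, rfl⟩, hy, hsub⟩ :=
    PrimeSpectrum.isBasis_basic_opens.exists_subset_of_mem_open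
    (Set.mem_range_self y) hopen.isOpen_range
  have hh : h ≠ 0 := by
    rintro rfl
    simp at hy
  -- Over an infinite field a nonempty open subset of affine space contains a rational point.
  obtain ⟨x, hx⟩ : ∃ x, MvPolynomial.eval x h ≠ 0 := by
    by_contra! hc
    exact hh (MvPolynomial.funext fun x => by simp [hc])
  let evx : MvPolynomial (Fin n) k →ₐ[k] k := MvPolynomial.aeval x
  let _ := evx.toRingHom.toAlgebra
  obtain ⟨P, hP⟩ := hsub
    (show (⟨RingHom.ker evx.toRingHom, RingHom.ker_isPrime _⟩ : PrimeSpectrum _) ∈ _ from hx)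
  -- The prime `P` over `x` only serves to show that the fibre `D` at `x` is nonzero: polynomials
  -- act on `κ` through evaluation at `x`, so `D` maps to `κ`.
  let κ := P.asIdeal.ResidueField
  have : P.asIdeal.comap (algebraMap (MvPolynomial (Fin n) k) T) = RingHom.ker evx.toRingHom :=
    congrArg PrimeSpectrum.asIdeal hP
  have hκ : algebraMap (MvPolynomial (Fin n) k) κ = (algebraMap k κ).comp evx.toRingHom := by
    have hker : ∀ q, evx q = 0 → algebraMap (MvPolynomial (Fin n) k) κ q = 0 := fun q hq => by
      have hq' : q ∈ RingHom.ker evx.toRingHom := hq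
      rw [← this, Ideal.mem_comap] at hq'
      rw [IsScalarTower.algebraMap_apply (MvPolynomial (Fin n) k) T κ]
      exact Ideal.algebraMap_residueField_eq_zero.mpr hq'
    have hC : ∀ a, algebraMap (MvPolynomial (Fin n) k) κ (MvPolynomial.C a) = algebraMap k κ a :=
      fun a => (IsScalarTower.algebraMap_apply k (MvPolynomial (Fin n) k) κ a).symm
    refine MvPolynomial.ringHom_ext (fun a => ?_) fun i => ?_
    · rw [hC]
      exact congrArg (algebraMap k κ) (MvPolynomial.aeval_C x a).symm
    · have := hker (MvPolynomial.X i - MvPolynomial.C (x i)) (by simp [evx])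
      rw [map_sub, sub_eq_zero, hC] at this
      rw [this]
      exact congrArg (algebraMap k κ) (MvPolynomial.aeval_X x i).symm
  have : IsScalarTower (MvPolynomial (Fin n) k) k κ := .of_algebraMap_eq' hκ
  let D := k ⊗[MvPolynomial (Fin n) k] T
  let δ : D →ₐ[k] κ := Algebra.TensorProduct.lift (Algebra.ofId k κ)
    (IsScalarTower.toAlgHom (MvPolynomial (Fin n) k) T κ) fun _ _ => .all _ _
  have : Nontrivial D := δ.toRingHom.domain_nontrivial
  obtain ⟨q⟩ : Nonempty (PrimeSpectrum D) := inferInstance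
  have : IsScalarTower k (MvPolynomial (Fin n) k) k :=
    .of_algebraMap_eq fun a => (MvPolynomial.aeval_C x a).symm
  let toD : T →ₐ[k] D := (Algebra.TensorProduct.includeRight :
    T →ₐ[MvPolynomial (Fin n) k] D).restrictScalars k
  -- An étale algebra over a separably closed field is a product of copies of the field; project to
  -- one factor.
  exact ⟨((Pi.evalAlgHom k _ q).comp
    (Algebra.FormallyEtale.equivPiOfIsSepClosed k D).toAlgHom).comp
    (toD.comp (IsScalarTower.toAlgHom k B T))⟩

/-! ### Matrix factorization as choice of compatible bases. -/

section GLFactors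

variable {V : Type*} {E : Type*} {s t : E → V} {R : V → Type*} {Q : E → Type*}
  [∀ v, CommRing (R v)] [∀ e, CommRing (Q e)]

/-- For a diagram of rings `R (s e) → Q e ← R (t e)`: every family of matrices in `GL_n (Q e)`
factors through matrices in `GL_n (R v)`. -/
def GLFactors (l : ∀ e, R (s e) →+* Q e) (r : ∀ e, R (t e) →+* Q e) (n : ℕ) : Prop :=
  ∀ g : ∀ e, GL (Fin n) (Q e), ∃ h : ∀ v, GL (Fin n) (R v), ∀ e,
    Matrix.GeneralLinearGroup.map (l e) (h (s e)) =
      g e * Matrix.GeneralLinearGroup.map (r e) (h (t e))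

variable {l : ∀ e, R (s e) →+* Q e} {r : ∀ e, R (t e) →+* Q e}

theorem GLFactors.of_one_le (H : ∀ n, 1 ≤ n → GLFactors l r n) (n : ℕ) : GLFactors l r n := by
  rcases n with _ | n
  · exact fun g => ⟨fun _ => 1, fun e => Subsingleton.elim _ _⟩
  · exact H _ (Nat.le_add_left 1 n)

variable {M : V → Type*} {N : E → Type*} [∀ v, AddCommGroup (M v)] [∀ e, AddCommGroup (N e)]
  [∀ v, Module (R v) (M v)] [∀ e, Module (Q e) (N e)]

/-- Families of vectors at the vertices which agree at the edges up to invertible matrices can be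
changed by invertible matrices at the vertices so that they agree at the edges. -/
theorem GLFactors.exists_compatible_families {n : ℕ} (H : GLFactors l r n)
    (φ : ∀ e, M (s e) →ₛₗ[l e] N e) (ψ : ∀ e, M (t e) →ₛₗ[r e] N e)
    (u : ∀ v, Fin n → M v) (g : ∀ e, GL (Fin n) (Q e))
    (hg : ∀ e i, ψ e (u (t e) i) = ∑ j, g e j i • φ e (u (s e) j)) :
    ∃ k : ∀ v, GL (Fin n) (R v), ∀ e i,
      φ e (∑ j, k (s e) j i • u (s e) j) = ψ e (∑ j, k (t e) j i • u (t e) j) := by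
  -- With vectors as rows, `ψ u_t = (φ u_s) g` and `l k_s = g (r k_t)`, so `φ (u_s k_s) = (φ u_s) g
  -- (r k_t) = ψ (u_t k_t)`.
  obtain ⟨k, hk⟩ := H g
  refine ⟨k, fun e i => ?_⟩
  have hk' : ∀ j, l e (k (s e) j i) = ∑ m, g e j m * r e (k (t e) m i) := fun j => by
    have := congrArg (fun A : GL (Fin n) (Q e) => A j i) (hk e)
    simpa [Matrix.mul_apply] using this
  simp only [map_sum, LinearMap.map_smulₛₗ, hk', hg, Finset.smul_sum, smul_smul, Finset.sum_smul]
  rw [Finset.sum_comm]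
  simp only [mul_comm]

/-- A basis over a commutative ring, changed by an invertible matrix. -/
theorem Module.Basis.exists_eq_sum_smul {ι A X : Type*} [Fintype ι] [DecidableEq ι] [CommRing A]
    [AddCommGroup X] [Module A X] (b : Module.Basis ι A X) (k : GL ι A) :
    ∃ c : Module.Basis ι A X, ∀ i, c i = ∑ j, k j i • b j := by
  have : IsUnit (b.toMatrix fun i => ∑ j, k j i • b j) := by
    convert k.isUnit
    ext i j
    simp [Module.Basis.toMatrix_apply, Finsupp.single_apply]
  have := (Module.Basis.is_basis_iff_det b).mpr ((Matrix.isUnit_iff_isUnit_det _).mp this)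
  exact ⟨.mk this.1 this.2.ge, fun i => by simp⟩

/-- Bases at the vertices can be chosen compatibly. -/
theorem GLFactors.exists_compatible_bases (H : ∀ n, GLFactors l r n) {ι : Type*} [Finite ι]
    (φ : ∀ e, M (s e) →ₛₗ[l e] N e) (ψ : ∀ e, M (t e) →ₛₗ[r e] N e)
    (u : ∀ v, Module.Basis ι (R v) (M v))
    (hφ : ∀ e, ∃ c : Module.Basis ι (Q e) (N e), ∀ i, c i = φ e (u (s e) i))
    (hψ : ∀ e, ∃ c : Module.Basis ι (Q e) (N e), ∀ i, c i = ψ e (u (t e) i)) :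
    ∃ (b : ∀ v, Module.Basis ι (R v) (M v)) (b' : ∀ e, Module.Basis ι (Q e) (N e)),
      (∀ e i, φ e (b (s e) i) = b' e i) ∧ ∀ e i, ψ e (b (t e) i) = b' e i := by
  obtain ⟨n, ⟨ε⟩⟩ := Finite.exists_equiv_fin ι
  choose c hc using hφ
  choose d hd using hψ
  let c' e := (c e).reindex ε
  let d' e := (d e).reindex ε
  -- The matrix at `e` is the change of basis between the images of the two vertex bases.
  obtain ⟨k, hk⟩ := (H n).exists_compatible_families φ ψ (fun v => (u v).reindex ε)
    (fun e => ⟨(c' e).toMatrix (d' e), (d' e).toMatrix (c' e),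
      (c' e).toMatrix_mul_toMatrix_flip _, (d' e).toMatrix_mul_toMatrix_flip _⟩) fun e i => by
    have := (c' e).sum_toMatrix_smul_self (d' e) i
    simp only [c', d', Module.Basis.reindex_apply, hc, hd] at this ⊢
    exact this.symm
  choose b hb using fun v => ((u v).reindex ε).exists_eq_sum_smul (k v)
  choose b' hb' using fun e =>
    (c' e).exists_eq_sum_smul (Matrix.GeneralLinearGroup.map (l e) (k (s e)))
  have hφb : ∀ e i, φ e (b (s e) i) = b' e i := fun e i => by
    simp [hb, hb', c', hc, LinearMap.map_smulₛₗ]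
  refine ⟨fun v => (b v).reindex ε.symm, fun e => (b' e).reindex ε.symm,
    fun e i => by simp [hφb], fun e i => ?_⟩
  simpa [hb, ← hφb] using (hk e (ε i)).symm

end GLFactors

/-! ### Gluing elements of tensor products from `F = F_Γ`. -/

namespace GammaOverField

variable {V : Type w₁} {E : Type w₂} {Γ : LooplessMultigraph V E} {F : Type u} [Field F]
  (K : GammaOverField Γ F) (o : Γ.Orientation)

/-- All gluing rests on this form of `F = F_Γ`; since an edge has only its left and right vertices,
one equality per edge suffices. -/
theorem exists_algebraMap_eq (a : ∀ v, K.vfield v)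
    (ha : ∀ e, K.ι (o.left_mem e) (a (o.left e)) = K.ι (o.right_mem e) (a (o.right e))) :
    ∃ c : F, ∀ v, algebraMap F (K.vfield v) c = a v := by
  obtain ⟨c, -, hc⟩ := K.bijOn_inverseLimit.surjOn (show a ∈ _ from fun e v w hv hw => by
    have hv' := hv
    have hw' := hw
    rw [o.ends_eq, Sym2.mem_iff] at hv' hw'
    rcases hv' with rfl | rfl <;> rcases hw' with rfl | rfl
    exacts [rfl, ha e, (ha e).symm, rfl])
  exact ⟨c, fun v => congrFun hc v⟩

/-- The map `F_v ⊗_F M → F_e ⊗_F M`. -/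
noncomputable abbrev ιTensor (M : Type*) [AddCommGroup M] [Module F M] {v : V} {e : E}
    (h : v ∈ Γ.ends e) : K.vfield v ⊗[F] M →ₗ[F] K.efield e ⊗[F] M :=
  LinearMap.rTensor M (K.ιAlg h).toLinearMap

theorem repr_ιTensor {ι M : Type*} [AddCommGroup M] [Module F M] (b : Module.Basis ι F M)
    {v : V} {e : E} (h : v ∈ Γ.ends e) (x : K.vfield v ⊗[F] M) (i : ι) :
    (b.baseChange (K.efield e)).repr (K.ιTensor M h x) i =
      K.ι h ((b.baseChange (K.vfield v)).repr x i) := by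
  induction x with
  | zero => simp
  | add x y hx hy => simp only [map_add, Finsupp.add_apply, hx, hy]
  | tmul a m =>
    simp only [ιTensor, LinearMap.rTensor_tmul, Module.Basis.baseChange_repr_tmul,
      AlgHom.toLinearMap_apply]
    exact (map_smul (K.ιAlg h) _ _).symm

theorem tmul_one_injective {M : Type*} [AddCommGroup M] [Module F M] (v : V) :
    Function.Injective fun m : M => (1 : K.vfield v) ⊗ₜ[F] m := 
  Module.FaithfullyFlat.tensorProduct_mk_injective M

/-- Compatible families of elements of `F_v ⊗_F M` come from `M`. -/
theorem exists_one_tmul_eq [Nonempty V] {M : Type*} [AddCommGroup M] [Module F M]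
    (x : ∀ v, K.vfield v ⊗[F] M)
    (hx : ∀ e, K.ιTensor M (o.left_mem e) (x (o.left e)) =
      K.ιTensor M (o.right_mem e) (x (o.right e))) :
    ∃ m : M, ∀ v, x v = 1 ⊗ₜ m := by
  let b := Module.Basis.ofVectorSpace F M
  choose c hc using fun i => K.exists_algebraMap_eq o
    (fun v => (b.baseChange (K.vfield v)).repr (x v) i) fun e => by
      rw [← repr_ιTensor, ← repr_ιTensor, hx]
  obtain ⟨v₀⟩ := ‹Nonempty V›
  -- `M` may be infinite-dimensional. Finiteness of the support can be read off at one vertex, as `F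
  -- → F_v₀` is injective.
  have hfin : c.support.Finite := by
    refine ((b.baseChange (K.vfield v₀)).repr (x v₀)).hasFiniteSupport.subset fun i hi => ?_
    simpa [← hc] using hi
  refine ⟨b.repr.symm (.ofSupportFinite c hfin), fun v => ?_⟩
  apply (b.baseChange (K.vfield v)).repr.injective
  ext i
  rw [← hc]
  simp [Module.Basis.baseChange_repr_tmul, Algebra.smul_def, Finsupp.ofSupportFinite_coe]

end GammaOverField

/-! ### Factorizability of `GL_n` in terms of `GLFactors`. -/

section GLFactorization

variable {V : Type w₁} {E : Type w₂} {Γ : LooplessMultigraph V E} {F : Type u} [Field F]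
  (K : GammaOverField Γ F) (o : Γ.Orientation)

theorem ClosedSubgroupGL.isFactorizable_GLn_iff (n : ℕ) :
    (GLn n F).IsFactorizable K o ↔
      GLFactors (R := K.vfield) (Q := K.efield) (fun e => K.ι (o.left_mem e))
        (fun e => K.ι (o.right_mem e)) n := by
  have key : ∀ (a : ∀ v, (GLn n F).points (K.vfield v)) (g : ∀ e, (GLn n F).points (K.efield e)),
      (GLn n F).factorMap K o a = g ↔ ∀ e,
        Matrix.GeneralLinearGroup.map (K.ι (o.left_mem e)) (a (o.left e)).1 =
          (g e).1 * Matrix.GeneralLinearGroup.map (K.ι (o.right_mem e)) (a (o.right e)).1 := by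
    intro a g
    rw [funext_iff]
    refine forall_congr' fun e => ?_
    rw [factorMap, mul_inv_eq_iff_eq_mul, Subtype.ext_iff]
    rfl
  have mem : ∀ {S : Type u} [CommRing S] [Algebra F S] (g : GL (Fin n) S),
      g ∈ (GLn n F).points S := fun g => by simp [points_GLn]
  constructor
  · intro H g
    obtain ⟨a, ha⟩ := H fun e => ⟨g e, mem _⟩
    exact ⟨fun v => a v, (key _ _).mp ha⟩
  · intro H g
    obtain ⟨a, ha⟩ := H fun e => g e
    exact ⟨fun v => ⟨a v, mem _⟩, (key _ _).mpr ha⟩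

theorem ClosedSubgroupGL.isSepFactorizable_iff {n : ℕ} (A : ClosedSubgroupGL n F) :
    A.IsSepFactorizable K o ↔
      ∀ g : ∀ e, A.points (K.efield e ⊗[F] SeparableClosure F),
        ∃ a : ∀ v, A.points (K.vfield v ⊗[F] SeparableClosure F), ∀ e,
        Matrix.GeneralLinearGroup.map (K.ιSep (o.left_mem e)).toRingHom (a (o.left e)).1 =
          (g e).1 * Matrix.GeneralLinearGroup.map (K.ιSep (o.right_mem e)).toRingHom
            (a (o.right e)).1 := by
  refine forall_congr' fun g => exists_congr fun a => ?_
  rw [funext_iff]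
  refine forall_congr' fun e => ?_
  rw [sepFactorMap, mul_inv_eq_iff_eq_mul, Subtype.ext_iff]
  rfl

theorem ClosedSubgroupGL.isSepFactorizable_GLn_iff (n : ℕ) :
    (GLn n F).IsSepFactorizable K o ↔
      GLFactors (R := fun v => K.vfield v ⊗[F] SeparableClosure F)
        (Q := fun e => K.efield e ⊗[F] SeparableClosure F)
        (fun e => (K.ιSep (o.left_mem e)).toRingHom)
        (fun e => (K.ιSep (o.right_mem e)).toRingHom) n := by
  rw [isSepFactorizable_iff]
  have mem : ∀ {S : Type u} [CommRing S] [Algebra F S] (g : GL (Fin n) S),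
      g ∈ (GLn n F).points S := fun g => by simp [points_GLn]
  constructor
  · intro H g
    obtain ⟨a, ha⟩ := H fun e => ⟨g e, mem _⟩
    exact ⟨fun v => a v, ha⟩
  · intro H g
    obtain ⟨a, ha⟩ := H fun e => g e
    exact ⟨fun v => ⟨a v, mem _⟩, ha⟩

theorem ClosedSubgroupGL.isSmooth_GLn (n : ℕ) : (GLn n F).IsSmooth := by
  have : Algebra.Smooth (MvPolynomial (Fin n × Fin n) F) (GLCoordRing n F) :=
    Algebra.Smooth.of_isLocalization_Away (Matrix.mvPolynomialX (Fin n) (Fin n) F).det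
  have : Algebra.Smooth F (MvPolynomial (Fin n × Fin n) F) := ⟨inferInstance, inferInstance⟩
  have : Algebra.Smooth F (GLCoordRing n F) :=
    Algebra.Smooth.comp F (MvPolynomial (Fin n × Fin n) F) (GLCoordRing n F)
  exact .of_equiv (AlgEquiv.quotientBot F (GLCoordRing n F)).symm

end GLFactorization

/-! ### Ascent of factorization to algebraic extensions. -/

namespace GammaOverField

variable {V : Type w₁} {E : Type w₂} {Γ : LooplessMultigraph V E} {F : Type u} [Field F]
  (K : GammaOverField Γ F) (o : Γ.Orientation)

/-- The map `F_v ⊗_F S → F_e ⊗_F S` as a homomorphism of algebras. -/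
noncomputable abbrev ιBase (S : Type*) [CommRing S] [Algebra F S] {v : V} {e : E}
    (h : v ∈ Γ.ends e) : K.vfield v ⊗[F] S →ₐ[F] K.efield e ⊗[F] S :=
  Algebra.TensorProduct.map (K.ιAlg h) (AlgHom.id F S)

theorem ιBase_smul (S : Type*) [CommRing S] [Algebra F S] {v : V} {e : E}
    (h : v ∈ Γ.ends e) (a : K.vfield v) (x : K.vfield v ⊗[F] S) :
    K.ιBase S h (a • x) = K.ι h a • K.ιBase S h x := by
  induction x with
  | zero => simp
  | add x y hx hy => simp only [smul_add, map_add, hx, hy]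
  | tmul b w =>
    simp only [TensorProduct.smul_tmul', Algebra.TensorProduct.map_tmul, smul_eq_mul, map_mul]
    rfl

/-- `F_v ⊗_F S → F_e ⊗_F S` applied to each coordinate, as a semilinear map. -/
noncomputable def ιVec (S : Type*) [CommRing S] [Algebra F S] (n : Type*) {v : V} {e : E}
    (h : v ∈ Γ.ends e) : (n → K.vfield v ⊗[F] S) →ₛₗ[K.ι h] (n → K.efield e ⊗[F] S) where
  toFun x i := K.ιBase S h (x i)
  map_add' x y := by ext; simp
  map_smul' a x := by ext i; simp [ιBase_smul]

@[simp]
theorem ιVec_apply (S : Type*) [CommRing S] [Algebra F S] (n : Type*) {v : V} {e : E}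
    (h : v ∈ Γ.ends e) (x : n → K.vfield v ⊗[F] S) (i : n) :
    K.ιVec S n h x i = K.ιBase S h (x i) := rfl

/-- Base change of the factorization property along a finite extension. -/
theorem glFactors_ιBase_of_finiteDimensional [Nonempty V]
    (H : ∀ n, GLFactors (R := K.vfield) (Q := K.efield) (fun e => K.ι (o.left_mem e))
      (fun e => K.ι (o.right_mem e)) n)
    (L : Type u) [Field L] [Algebra F L] [FiniteDimensional F L] (n : ℕ) :
    GLFactors (R := fun v => K.vfield v ⊗[F] L) (Q := fun e => K.efield e ⊗[F] L)
      (fun e => (K.ιBase L (o.left_mem e)).toRingHom)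
      (fun e => (K.ιBase L (o.right_mem e)).toRingHom) n := by
  intro g
  let _ : ∀ v, Algebra L (K.vfield v ⊗[F] L) := fun v => Algebra.TensorProduct.rightAlgebra
  have hsmul : ∀ v (a : L) (x : K.vfield v ⊗[F] L), a • x = (1 ⊗ₜ a) * x := fun v a x => by
    rw [Algebra.smul_def]; rfl
  let β := Module.finBasis F L
  -- Over `F_e` the matrix `g e` is an automorphism of a space of dimension `n [L : F]`; the
  -- hypothesis is applied in that rank.
  let G e : (Fin n → K.efield e ⊗[F] L) ≃ₗ[K.efield e] (Fin n → K.efield e ⊗[F] L) :=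
    (Matrix.toLin'OfInv (g e).inv_mul (g e).mul_inv).restrictScalars (K.efield e)
  have hG : ∀ e x, G e x = (g e).1.mulVec x := fun e x => rfl
  obtain ⟨b, b', hb, hb'⟩ := GLFactors.exists_compatible_bases H
    (fun e => K.ιVec L (Fin n) (o.left_mem e))
    (fun e => (G e).toLinearMap.comp (K.ιVec L (Fin n) (o.right_mem e)))
    (fun v => Pi.basis fun _ : Fin n => β.baseChange (K.vfield v))
    (fun e => ⟨Pi.basis fun _ : Fin n => β.baseChange (K.efield e), fun ⟨i, j⟩ => by
      ext m
      by_cases h : m = i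
      · subst h; simp
      · simp [h]⟩)
    (fun e => ⟨(Pi.basis fun _ : Fin n => β.baseChange (K.efield e)).map (G e), fun ⟨i, j⟩ => by
      rw [Module.Basis.map_apply, LinearMap.comp_apply]
      refine congrArg (G e) ?_
      ext m
      by_cases h : m = i
      · subst h; simp
      · simp [h]⟩)
  -- The space of global solutions; an `L`-basis of it supplies the columns of the factorization.
  let W : Submodule L (∀ v, Fin n → K.vfield v ⊗[F] L) :=
    { carrier := {x | ∀ e, K.ιVec L (Fin n) (o.left_mem e) (x (o.left e)) =
        (g e).1.mulVec (K.ιVec L (Fin n) (o.right_mem e) (x (o.right e)))}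
      add_mem' := fun hx hy e => by
        simp only [Set.mem_ofPred_eq] at hx hy
        simp only [Pi.add_apply, map_add, hx, hy, Matrix.mulVec_add]
      zero_mem' := fun e => by simp
      smul_mem' := fun a x hx e => by
        ext i
        have h₁ : ∀ {v : V} (h : v ∈ Γ.ends e) (x : Fin n → K.vfield v ⊗[F] L),
            K.ιVec L (Fin n) h (a • x) =
              ((1 : K.efield e) ⊗ₜ[F] a) • K.ιVec L (Fin n) h x := fun h x => by
          ext i
          simp [hsmul]
        rw [Pi.smul_apply, Pi.smul_apply, h₁, h₁, hx e, Matrix.mulVec_smul] }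
  have hbW : ∀ i, (fun v => b v i) ∈ W := fun i e => (hb e i).trans (hb' e i).symm
  -- The coordinates of a solution in the compatible bases agree at the edges, so they come from
  -- `F`.
  have hWb : ∀ x ∈ W, x ∈ Submodule.span F (Set.range fun i v => b v i) := fun x hx => by
    choose c hc using fun i => K.exists_algebraMap_eq o (fun v => (b v).repr (x v) i) fun e => by
      have h₁ := hx e
      have h₂ : (g e).1.mulVec (K.ιVec L (Fin n) (o.right_mem e) (x (o.right e))) =
        G e (K.ιVec L (Fin n) (o.right_mem e) (x (o.right e))) := (hG e _).symm
      rw [h₂, ← (b (o.left e)).sum_repr (x (o.left e)),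
        ← (b (o.right e)).sum_repr (x (o.right e))] at h₁
      simp only [LinearMap.coe_comp, Function.comp_apply, LinearEquiv.coe_coe] at hb'
      simp only [map_sum, LinearMap.map_smulₛₗ, hb, hb', map_smul] at h₁
      have := congrArg (fun y => (b' e).repr y i) h₁
      simpa [Finsupp.single_apply] using this
    have : x = ∑ i, c i • fun v => b v i := by
      funext v
      rw [← (b v).sum_repr (x v), Finset.sum_apply]
      refine Finset.sum_congr rfl fun i _ => ?_
      rw [← hc, Pi.smul_apply, algebraMap_smul]
    rw [this]
    exact Submodule.sum_mem _ fun i _ => Submodule.smul_mem _ _ (Submodule.subset_span ⟨i, rfl⟩)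
  have hbi : LinearIndependent F fun i v => b v i := by
    obtain ⟨v₀⟩ := ‹Nonempty V›
    refine .of_comp (LinearMap.proj (R := F) (φ := fun v => Fin n → K.vfield v ⊗[F] L) v₀) ?_
    exact (b v₀).linearIndependent.restrict_scalars' F
  let w : Module.Basis (Σ _ : Fin n, Fin (Module.finrank F L)) F (W.restrictScalars F) :=
    .mk (v := fun i => ⟨fun v => b v i, hbW i⟩)
      (.of_comp (W.restrictScalars F).subtype hbi) fun ⟨x, hx⟩ _ => by
        have hx' := hWb x hx
        have hr : (Set.range fun i v => b v i) = (W.restrictScalars F).subtype ''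
            Set.range fun i => ⟨fun v => b v i, hbW i⟩ := by
          rw [← Set.range_comp]; rfl
        rw [hr, ← Submodule.map_span] at hx'
        obtain ⟨y, hy, rfl⟩ := hx'
        exact hy
  -- `W` has `F`-dimension `n [L : F]`; divide by `[L : F]`.
  have hrank : Module.finrank L W = n := by
    have h := Module.finrank_mul_finrank F L W
    have hw : Module.finrank F W = _ := Module.finrank_eq_card_basis w
    rw [hw] at h
    simp only [Fintype.card_sigma, Fintype.card_fin, Finset.sum_const, Finset.card_univ,
      smul_eq_mul] at h
    exact Nat.eq_of_mul_eq_mul_left (Module.finrank_pos (R := F) (M := L)) (h.trans (mul_comm _ _))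
  have : Module.Finite F W := .of_basis w
  have : Module.Finite L W := .of_restrictScalars_finite F L W
  let u := Module.finBasisOfFinrankEq L W hrank
  let h v : Matrix (Fin n) (Fin n) (K.vfield v ⊗[F] L) := .of fun i j => (u j).1 v i
  -- The columns of `h v` generate: each `b v i` is an `L`-combination of them, and the `b v i` span
  -- over `F_v`.
  have hunit : ∀ v, IsUnit (h v) := fun v => by
    rw [← Matrix.mulVec_surjective_iff_isUnit]
    have : ∀ x, x ∈ LinearMap.range (h v).mulVecLin := fun x => by
      rw [← (b v).sum_repr x]
      refine Submodule.sum_mem _ fun i _ => Submodule.smul_of_tower_mem _ _ ?_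
      obtain ⟨a, ha⟩ : ∃ a : Fin n → L, ∑ j, a j • u j = ⟨fun v => b v i, hbW i⟩ :=
        ⟨_, u.sum_repr _⟩
      refine ⟨fun j => 1 ⊗ₜ a j, .trans ?_ (congrFun (congrArg Subtype.val ha) v)⟩
      ext m
      simp [h, Matrix.mulVec, dotProduct, hsmul, mul_comm]
    exact this
  refine ⟨fun v => (hunit v).unit, fun e => ?_⟩
  ext i j
  have := congrFun ((u j).2 e) i
  simpa [Matrix.mul_apply, Matrix.mulVec, dotProduct, h] using this

end GammaOverField

/-- A tensor is a finite sum of pure ones. Allowing every `L` that contains `s` lets the finite sets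
of several tensors be united. -/
theorem TensorProduct.exists_finset_mem_range_of_subset {F : Type*} [Field F] (S Ω : Type*)
    [CommRing S] [Algebra F S] [Field Ω] [Algebra F Ω] (z : S ⊗[F] Ω) :
    ∃ s : Finset Ω, ∀ L : IntermediateField F Ω, (s : Set Ω) ⊆ L →
      z ∈ (Algebra.TensorProduct.map (AlgHom.id F S) L.val).range := by
  classical
  induction z with
  | zero => exact ⟨∅, fun L _ => zero_mem _⟩
  | tmul a b => exact ⟨{b}, fun L hL => ⟨a ⊗ₜ ⟨b, hL (by simp)⟩, by simp⟩⟩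
  | add x y hx hy =>
    obtain ⟨s, hs⟩ := hx
    obtain ⟨s', hs'⟩ := hy
    refine ⟨s ∪ s', fun L hL => add_mem (hs L ?_) (hs' L ?_)⟩
    · exact subset_trans (by simp) hL
    · exact subset_trans (by simp) hL

/-- Finitely many invertible matrices over algebras `S e ⊗ Ω`, with `Ω` algebraic over `F`, are
defined over `S e ⊗ L` for a common finite subextension `L`. -/
theorem Matrix.GeneralLinearGroup.exists_finiteDimensional_map_eq {F : Type*} [Field F]
    {E : Type*} [Finite E] (S : E → Type*) [∀ e, CommRing (S e)] [∀ e, Algebra F (S e)]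
    (Ω : Type*) [Field Ω] [Algebra F Ω] [Algebra.IsAlgebraic F Ω] (n : ℕ)
    (g : ∀ e, GL (Fin n) (S e ⊗[F] Ω)) :
    ∃ L : IntermediateField F Ω, FiniteDimensional F L ∧
      ∃ g' : ∀ e, GL (Fin n) (S e ⊗[F] L), ∀ e, Matrix.GeneralLinearGroup.map
        (Algebra.TensorProduct.map (AlgHom.id F (S e)) L.val).toRingHom (g' e) = g e := by
  -- The Boolean selects the matrix or its inverse: both must have entries over `L` for
  -- invertibility there.
  choose s hs using fun e (b : Bool) (p : Fin n × Fin n) =>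
    TensorProduct.exists_finset_mem_range_of_subset (S e) Ω
      ((if b then (g e).1 else (g e)⁻¹.1) p.1 p.2)
  let s' : Set Ω := ⋃ e, ⋃ b, ⋃ p, (s e b p : Set Ω)
  have hs'fin : s'.Finite :=
    Set.finite_iUnion fun e => Set.finite_iUnion fun b => Set.finite_iUnion fun p =>
      Finset.finite_toSet _
  let L := IntermediateField.adjoin F s'
  have : Finite s' := hs'fin
  have : FiniteDimensional F L :=
    IntermediateField.finiteDimensional_adjoin fun x _ => Algebra.IsIntegral.isIntegral x
  let j e : S e ⊗[F] L →ₐ[F] S e ⊗[F] Ω := Algebra.TensorProduct.map (AlgHom.id F (S e)) L.val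
  have hj : ∀ e, Function.Injective (j e) := fun e =>
    Module.Flat.lTensor_preserves_injective_linearMap (M := S e) L.val.toLinearMap
      L.val.injective
  have hL : ∀ e b p, (s e b p : Set Ω) ⊆ L := fun e b p x hx =>
    IntermediateField.subset_adjoin F s' <|
      Set.mem_iUnion.mpr ⟨e, Set.mem_iUnion.mpr ⟨b, Set.mem_iUnion.mpr ⟨p, hx⟩⟩⟩
  choose m hm using fun e b p => hs e b p L (hL e b p)
  let A e (b : Bool) : Matrix (Fin n) (Fin n) (S e ⊗[F] L) := .of fun i k => m e b (i, k)
  have hA : ∀ e b, (j e).toRingHom.mapMatrix (A e b) = if b then (g e).1 else (g e)⁻¹.1 := by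
    intro e b
    ext i k
    exact hm e b (i, k)
  have hinj : ∀ e, Function.Injective ((j e).toRingHom.mapMatrix (m := Fin n)) := fun e X Y h => by
    ext i k
    exact hj e (congrFun (congrFun h i) k)
  refine ⟨L, this, fun e => ⟨A e true, A e false, hinj e ?_, hinj e ?_⟩, fun e => ?_⟩
  · rw [map_mul, hA, hA, map_one]
    exact (g e).mul_inv
  · rw [map_mul, hA, hA, map_one]
    exact (g e).inv_mul
  · ext1
    exact hA e true

namespace GammaOverField

variable {V : Type w₁} {E : Type w₂} {Γ : LooplessMultigraph V E} {F : Type u} [Field F]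
  (K : GammaOverField Γ F) (o : Γ.Orientation)

/-- Base change of the factorization property along an algebraic extension. -/
theorem glFactors_ιBase_of_isAlgebraic [Nonempty V] [Finite E]
    (H : ∀ n, GLFactors (R := K.vfield) (Q := K.efield) (fun e => K.ι (o.left_mem e))
      (fun e => K.ι (o.right_mem e)) n)
    (Ω : Type u) [Field Ω] [Algebra F Ω] [Algebra.IsAlgebraic F Ω] (n : ℕ) :
    GLFactors (R := fun v => K.vfield v ⊗[F] Ω) (Q := fun e => K.efield e ⊗[F] Ω)
      (fun e => (K.ιBase Ω (o.left_mem e)).toRingHom)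
      (fun e => (K.ιBase Ω (o.right_mem e)).toRingHom) n := by
  intro g
  obtain ⟨L, _, g', hg'⟩ :=
    Matrix.GeneralLinearGroup.exists_finiteDimensional_map_eq K.efield Ω n g
  let j (S : Type u) [CommRing S] [Algebra F S] : S ⊗[F] L →ₐ[F] S ⊗[F] Ω :=
    Algebra.TensorProduct.map (AlgHom.id F S) L.val
  obtain ⟨h, hh⟩ := K.glFactors_ιBase_of_finiteDimensional o H L n g'
  refine ⟨fun v => Matrix.GeneralLinearGroup.map (j (K.vfield v)).toRingHom (h v), fun e => ?_⟩
  have hcomm : ∀ {v} (hv : v ∈ Γ.ends e) x,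
      K.ιBase Ω hv (j _ x) = j _ (K.ιBase L hv x) := fun hv x => by
    have : (K.ιBase Ω hv).comp (j _) = (j _).comp (K.ιBase L hv) := by
      ext <;> simp [j]
    exact DFunLike.congr_fun this x
  have := congrArg (Matrix.GeneralLinearGroup.map (j (K.efield e)).toRingHom) (hh e)
  rw [map_mul] at this
  rw [hg'] at this
  convert! this using 1
  · ext i k
    exact hcomm _ _
  · congr 1
    ext i k
    exact hcomm _ _

end GammaOverField

/-! ### Descent of factorization along field extensions. -/

namespace GammaOverField

variable {V : Type w₁} {E : Type w₂} {Γ : LooplessMultigraph V E} {F : Type u} [Field F]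
  (K : GammaOverField Γ F) (o : Γ.Orientation)

/-- The factorization property descends along field extensions. -/
theorem glFactors_of_glFactors_ιBase [Nonempty V] (L : Type u) [Field L] [Algebra F L] (n : ℕ)
    (H : GLFactors (R := fun v => K.vfield v ⊗[F] L) (Q := fun e => K.efield e ⊗[F] L)
      (fun e => (K.ιBase L (o.left_mem e)).toRingHom)
      (fun e => (K.ιBase L (o.right_mem e)).toRingHom) n) :
    GLFactors (R := K.vfield) (Q := K.efield) (fun e => K.ι (o.left_mem e))
      (fun e => K.ι (o.right_mem e)) n := by
  intro g
  obtain ⟨h, hh⟩ := H fun e => Matrix.GeneralLinearGroup.map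
    (Algebra.TensorProduct.includeLeft : K.efield e →ₐ[F] K.efield e ⊗[F] L).toRingHom (g e)
  have hh' : ∀ e a m, K.ιBase L (o.left_mem e) (h (o.left e) a m) =
      ∑ j, g e a j • K.ιBase L (o.right_mem e) (h (o.right e) j m) := fun e a m => by
    have := congrArg (fun A : GL (Fin n) (K.efield e ⊗[F] L) => A a m) (hh e)
    simpa [Matrix.mul_apply, Algebra.smul_def] using this
  let W : Submodule F (∀ v, Fin n → K.vfield v) :=
    { carrier := {x | ∀ e a, K.ι (o.left_mem e) (x (o.left e) a) =
        ∑ j, g e a j * K.ι (o.right_mem e) (x (o.right e) j)}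
      add_mem' := fun hx hy e a => by
        simp [hx e, hy e, mul_add, Finset.sum_add_distrib]
      zero_mem' := fun e => by simp
      smul_mem' := fun c x hx e a => by
        have hι : ∀ {v : V} (h : v ∈ Γ.ends e) (y : K.vfield v), K.ι h (c • y) = c • K.ι h y :=
          fun h y => map_smul (K.ιAlg h) c y
        simp [hι, hx e, Finset.smul_sum] }
  let β := Module.Basis.ofVectorSpace F L
  -- The relation between the columns of `h` has coefficients in `F_e`, so it holds for each
  -- coordinate along `β`.
  have hw : ∀ i m, (fun v a => (β.baseChange (K.vfield v)).repr (h v a m) i) ∈ W := by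
    intro i m e a
    have := congrArg (fun y => (β.baseChange (K.efield e)).repr y i) (hh' e a m)
    simp only [map_sum, map_smul, Finsupp.coe_finsetSum, Finset.sum_apply, Finsupp.smul_apply,
      smul_eq_mul] at this
    have hr : ∀ {v : V} (hv : v ∈ Γ.ends e) (y : K.vfield v ⊗[F] L),
        K.ι hv ((β.baseChange (K.vfield v)).repr y i) =
          (β.baseChange (K.efield e)).repr (K.ιBase L hv y) i := fun hv y =>
      (K.repr_ιTensor β hv y i).symm
    simpa only [hr] using this
  let b := Module.Basis.ofVectorSpace F W
  -- A linear form vanishing on all solutions at `v` kills the columns of `h v`, coordinate by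
  -- coordinate, and `h v` is invertible.
  have hspan : ∀ v, Submodule.span (K.vfield v) (Set.range fun i => (b i).1 v) = ⊤ := by
    intro v
    by_contra hlt
    obtain ⟨f, hf, hle⟩ := Submodule.exists_le_ker_of_lt_top _ (lt_top_iff_ne_top.mpr hlt)
    refine hf ?_
    have hfW : ∀ x ∈ W, f (x v) = 0 := by
      intro x hx
      obtain ⟨c, hc⟩ : ∃ c, Finsupp.linearCombination F b c = ⟨x, hx⟩ :=
        ⟨_, b.linearCombination_repr _⟩
      have : x = ∑ i ∈ c.support, c i • (b i).1 := by
        simpa [Finsupp.linearCombination_apply, Finsupp.sum] using congrArg Subtype.val hc.symm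
      rw [this, Finset.sum_apply]
      rw [← LinearMap.mem_ker]
      refine Submodule.sum_mem _ fun i _ => ?_
      rw [Pi.smul_apply]
      exact Submodule.smul_of_tower_mem _ _ <| hle <| Submodule.subset_span (Set.mem_range_self i)
    have hfx : ∀ x, f x = ∑ a, x a * f (Pi.single a 1) := fun x => by
      conv_lhs => rw [← Finset.univ_sum_single x, map_sum]
      refine Finset.sum_congr rfl fun a _ => ?_
      rw [← smul_eq_mul, ← map_smul, ← Pi.single_smul, smul_eq_mul, mul_one]
    have hzero : Matrix.vecMul (fun a => f (Pi.single a 1) ⊗ₜ[F] (1 : L)) (h v).1 = 0 := by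
      ext1 m
      apply (β.baseChange (K.vfield v)).repr.injective
      ext i
      have := hfW _ (hw i m)
      rw [hfx] at this
      have hs : ∀ (c : K.vfield v) (y : K.vfield v ⊗[F] L), c ⊗ₜ[F] (1 : L) * y = c • y :=
        fun c y => (Algebra.smul_def c y).symm
      simpa [Matrix.vecMul, dotProduct, hs, mul_comm] using this
    have hzero' := congrArg (Matrix.vecMul · (h v)⁻¹.1) hzero
    simp only [Matrix.vecMul_vecMul, Units.mul_inv, Matrix.vecMul_one, Matrix.zero_vecMul] at hzero'
    ext a
    have := congrFun hzero' a
    exact Algebra.TensorProduct.includeLeft_injective (S := F) (algebraMap F L).injective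
      (this.trans (map_zero _).symm)
  -- The vectors `h_v⁻¹ x_v` agree at the edges since `x` and `h` satisfy the same relation, so they
  -- come from `L^n`.
  have hy : ∀ x ∈ W, ∃ y : Fin n → L, ∀ v,
      (h v).1.mulVec (fun m => 1 ⊗ₜ y m) = fun a => x v a ⊗ₜ 1 := by
    intro x hx
    let xt v : Fin n → K.vfield v ⊗[F] L := fun a => x v a ⊗ₜ 1
    have hxt : ∀ e, K.ιBase L (o.left_mem e) ∘ xt (o.left e) =
        (Matrix.GeneralLinearGroup.map (Algebra.TensorProduct.includeLeft :
          K.efield e →ₐ[F] K.efield e ⊗[F] L).toRingHom (g e)).1.mulVec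
          (K.ιBase L (o.right_mem e) ∘ xt (o.right e)) := fun e => by
      ext a
      have hι : ∀ {v : V} (h : v ∈ Γ.ends e) (y : K.vfield v), K.ιAlg h y = K.ι h y :=
        fun h y => rfl
      simp [xt, hι, hx e a, Matrix.mulVec, dotProduct, TensorProduct.sum_tmul]
    have hmap : ∀ {v e} (hv : v ∈ Γ.ends e) a, K.ιBase L hv ((h v)⁻¹.1.mulVec (xt v) a) =
        (Matrix.GeneralLinearGroup.map (K.ιBase L hv).toRingHom (h v))⁻¹.1.mulVec
          (K.ιBase L hv ∘ xt v) a := fun {v e} hv a => by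
      rw [← map_inv]
      exact RingHom.map_mulVec (K.ιBase L hv).toRingHom _ _ _
    choose y hy using fun a => K.exists_one_tmul_eq o
      (fun v => (h v)⁻¹.1.mulVec (xt v) a) fun e => by
        change K.ιBase L _ _ = K.ιBase L _ _
        rw [hmap, hmap, hh e, hxt e, mul_inv_rev, Units.val_mul, Matrix.mulVec_mulVec,
          mul_assoc, Units.inv_mul, mul_one]
    refine ⟨y, fun v => ?_⟩
    have : (fun m => 1 ⊗ₜ[F] y m) = (h v)⁻¹.1.mulVec (xt v) := funext fun a => (hy a v).symm
    rw [this, Matrix.mulVec_mulVec, Units.mul_inv, Matrix.one_mulVec]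
  choose y hy using fun i => hy (b i).1 (b i).2
  -- Applying `h v` to an `L`-relation among the `y i` gives `∑ b_i ⊗ a_i = 0`; its coordinates
  -- along `β` are `F`-relations among the `b i`.
  have hyi : LinearIndependent L y := by
    rw [linearIndependent_iff']
    intro s a ha i hi
    have hsum : ∀ v k, ∑ i ∈ s, (b i).1 v k ⊗ₜ[F] a i = 0 := fun v k => by
      have h₁ : (h v).1.mulVec (∑ i ∈ s, (1 ⊗ₜ[F] a i : K.vfield v ⊗[F] L) •
          fun m => 1 ⊗ₜ y i m) = 0 := by
        convert! Matrix.mulVec_zero (h v).1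
        ext1 m
        have := congrArg (fun z => (1 : K.vfield v) ⊗ₜ[F] z) (congrFun ha m)
        simpa [TensorProduct.tmul_sum] using this
      rw [Matrix.mulVec_sum] at h₁
      simp only [Matrix.mulVec_smul, hy] at h₁
      simpa using congrFun h₁ k
    apply β.repr.injective
    ext κ
    rw [map_zero, Finsupp.zero_apply]
    refine linearIndependent_iff'.mp b.linearIndependent s (fun i => β.repr (a i) κ) ?_ i hi
    ext v k
    have := congrArg (fun z => (β.baseChange (K.vfield v)).repr z κ) (hsum v k)
    simpa using this
  have : Finite (Module.Basis.ofVectorSpaceIndex F W) := hyi.finite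
  let _ := Fintype.ofFinite (Module.Basis.ofVectorSpaceIndex F W)
  -- At most `n`, by independence in `L^n`; at least `n`, since the values at a vertex span `F_v^n`.
  have hcard : Fintype.card (Module.Basis.ofVectorSpaceIndex F W) = n := by
    apply le_antisymm
    · simpa using hyi.fintype_card_le_finrank
    · obtain ⟨v⟩ := ‹Nonempty V›
      have := finrank_range_le_card (R := K.vfield v) (fun i => (b i).1 v)
      rw [Set.finrank, hspan] at this
      simpa using this
  let ε := Fintype.equivFinOfCardEq hcard
  have hunit : ∀ v, IsUnit (Matrix.of fun a i => (b (ε.symm i)).1 v a) := fun v => by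
    rw [← Matrix.mulVec_surjective_iff_isUnit]
    have : ∀ x, x ∈ LinearMap.range
        (Matrix.of fun a i => (b (ε.symm i)).1 v a : Matrix (Fin n) (Fin n) _).mulVecLin := by
      rw [← Submodule.eq_top_iff', eq_top_iff, ← hspan v, Submodule.span_le]
      rintro _ ⟨i, rfl⟩
      refine ⟨Pi.single (ε i) 1, ?_⟩
      ext a
      simp
    exact this
  refine ⟨fun v => (hunit v).unit, fun e => ?_⟩
  ext a i
  have := (b (ε.symm i)).2 e a
  simpa [Matrix.mul_apply] using this

end GammaOverField

/-! ### Universal points of closed subschemes of `GL_n`. -/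

section UniversalPoint

variable (n : ℕ) (F : Type u) [Field F]

/-- The universal invertible matrix, over the coordinate ring of `GL_n`. -/
noncomputable def universalGL : GL (Fin n) (GLCoordRing n F) :=
  Matrix.GeneralLinearGroup.mk'' ((algebraMap (MvPolynomial (Fin n × Fin n) F)
    (GLCoordRing n F)).mapMatrix (Matrix.mvPolynomialX (Fin n) (Fin n) F)) <| by
    rw [← RingHom.map_det]
    exact IsLocalization.Away.algebraMap_isUnit _

variable {n F}

theorem evalGL_algebraMap {S : Type u} [CommRing S] [Algebra F S] (g : GL (Fin n) S)
    (p : MvPolynomial (Fin n × Fin n) F) :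
    evalGL g (algebraMap _ (GLCoordRing n F) p) =
      MvPolynomial.aeval (fun p : Fin n × Fin n => g p.1 p.2) p := by
  simp [evalGL]

theorem GLCoordRing.algHom_ext {S : Type u} [CommRing S] [Algebra F S]
    {φ ψ : GLCoordRing n F →ₐ[F] S}
    (h : Matrix.GeneralLinearGroup.map φ.toRingHom (universalGL n F) =
      Matrix.GeneralLinearGroup.map ψ.toRingHom (universalGL n F)) : φ = ψ := by
  apply AlgHom.coe_ringHom_injective
  apply IsLocalization.ringHom_ext
    (Submonoid.powers (Matrix.mvPolynomialX (Fin n) (Fin n) F).det)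
  apply MvPolynomial.ringHom_ext
  · intro r
    have h (φ : GLCoordRing n F →ₐ[F] S) : φ (algebraMap _ (GLCoordRing n F)
        (MvPolynomial.C r : MvPolynomial (Fin n × Fin n) F)) = algebraMap F S r := by
      rw [← MvPolynomial.algebraMap_eq, ← IsScalarTower.algebraMap_apply, φ.commutes]
    exact (h φ).trans (h ψ).symm
  · intro p
    exact congrArg (fun g : GL (Fin n) S => g p.1 p.2) h

theorem map_evalGL_universalGL {S : Type u} [CommRing S] [Algebra F S] (g : GL (Fin n) S) :
    Matrix.GeneralLinearGroup.map (evalGL g).toRingHom (universalGL n F) = g := by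
  ext i j
  exact (evalGL_algebraMap g _).trans (MvPolynomial.aeval_X _ _)

theorem evalGL_map_universalGL {S : Type u} [CommRing S] [Algebra F S]
    (φ : GLCoordRing n F →ₐ[F] S) :
    evalGL (Matrix.GeneralLinearGroup.map φ.toRingHom (universalGL n F)) = φ :=
  GLCoordRing.algHom_ext (map_evalGL_universalGL _)

namespace ClosedSubgroupGL

variable (A : ClosedSubgroupGL n F)

instance : Nontrivial (GLCoordRing n F ⧸ A.ideal) := by
  refine Ideal.Quotient.nontrivial_iff.mpr fun h => ?_
  have := A.one_mem F 1 (h ▸ trivial)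
  simp at this

/-- The universal point of `A`, over its coordinate ring. -/
noncomputable def universalPoint : GL (Fin n) (GLCoordRing n F ⧸ A.ideal) :=
  Matrix.GeneralLinearGroup.map (Ideal.Quotient.mkₐ F A.ideal).toRingHom (universalGL n F)

/-- With `exists_map_universalPoint`, this says that the coordinate ring represents the functor of
points of `A`. -/
theorem map_universalPoint_mem {S : Type u} [CommRing S] [Algebra F S]
    (φ : GLCoordRing n F ⧸ A.ideal →ₐ[F] S) :
    Matrix.GeneralLinearGroup.map φ.toRingHom A.universalPoint ∈ A.points S := by
  intro f hf
  have := evalGL_map_universalGL (φ.comp (Ideal.Quotient.mkₐ F A.ideal))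
  change evalGL (Matrix.GeneralLinearGroup.map (φ.comp (Ideal.Quotient.mkₐ F A.ideal)).toRingHom
    (universalGL n F)) f = 0
  rw [this]
  simp [Ideal.Quotient.eq_zero_iff_mem.mpr hf]

theorem exists_map_universalPoint {S : Type u} [CommRing S] [Algebra F S] {g : GL (Fin n) S}
    (hg : g ∈ A.points S) : ∃ φ : GLCoordRing n F ⧸ A.ideal →ₐ[F] S,
      Matrix.GeneralLinearGroup.map φ.toRingHom A.universalPoint = g :=
  ⟨Ideal.Quotient.liftₐ A.ideal (evalGL g) hg, map_evalGL_universalGL g⟩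

end ClosedSubgroupGL

end UniversalPoint

section ZeroLocus

variable {n : ℕ} {L : Type u} [Field L] {κ : Type*} (f : κ → MvPolynomial (Fin n × Fin n) L)

/-- The coordinate ring of the closed subscheme of `GL_n` cut out by polynomials. -/
abbrev ZeroLocusRing : Type u :=
  GLCoordRing n L ⧸ Ideal.span (Set.range fun i => algebraMap _ (GLCoordRing n L) (f i))

/-- The universal point of the closed subscheme of `GL_n` cut out by polynomials. -/
noncomputable def ZeroLocusRing.point : GL (Fin n) (ZeroLocusRing f) :=
  Matrix.GeneralLinearGroup.map (Ideal.Quotient.mkₐ L _).toRingHom (universalGL n L)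

theorem ZeroLocusRing.aeval_map_point {T : Type u} [CommRing T] [Algebra L T]
    (φ : ZeroLocusRing f →ₐ[L] T) (i : κ) :
    MvPolynomial.aeval (fun p : Fin n × Fin n =>
      Matrix.GeneralLinearGroup.map φ.toRingHom (point f) p.1 p.2) (f i) = 0 := by
  rw [← evalGL_algebraMap]
  have := evalGL_map_universalGL (φ.comp (Ideal.Quotient.mkₐ L _))
  change evalGL (Matrix.GeneralLinearGroup.map (φ.comp (Ideal.Quotient.mkₐ L _)).toRingHom
    (universalGL n L)) _ = 0
  rw [this]
  simp [Ideal.Quotient.eq_zero_iff_mem.mpr (Ideal.subset_span (Set.mem_range_self i))]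

theorem ZeroLocusRing.exists_map_point {T : Type u} [CommRing T] [Algebra L T]
    {g : GL (Fin n) T}
    (hg : ∀ i, MvPolynomial.aeval (fun p : Fin n × Fin n => g p.1 p.2) (f i) = 0) :
    ∃ φ : ZeroLocusRing f →ₐ[L] T, Matrix.GeneralLinearGroup.map φ.toRingHom (point f) = g := by
  have hle : Ideal.span (Set.range fun i => algebraMap _ (GLCoordRing n L) (f i)) ≤
      RingHom.ker (evalGL g : GLCoordRing n L →ₐ[L] T) := by
    rw [Ideal.span_le]
    rintro _ ⟨i, rfl⟩
    exact (evalGL_algebraMap g (f i)).trans (hg i)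
  exact ⟨Ideal.Quotient.liftₐ _ (evalGL g) fun a ha => hle ha, map_evalGL_universalGL g⟩

theorem GLCoordRing.quotient_algHom_ext {I : Ideal (GLCoordRing n L)} {T : Type u} [CommRing T]
    [Algebra L T] {φ ψ : GLCoordRing n L ⧸ I →ₐ[L] T}
    (h : Matrix.GeneralLinearGroup.map φ.toRingHom (Matrix.GeneralLinearGroup.map
      (Ideal.Quotient.mkₐ L I).toRingHom (universalGL n L)) =
      Matrix.GeneralLinearGroup.map ψ.toRingHom (Matrix.GeneralLinearGroup.map
      (Ideal.Quotient.mkₐ L I).toRingHom (universalGL n L))) : φ = ψ :=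
  Ideal.Quotient.algHom_ext _ (GLCoordRing.algHom_ext h)

end ZeroLocus

/-- Let `X` and `Y` be the universal points of two subfunctors of `GL_n`, over algebras `R` over
`F` and `B` over `L`. If over an algebra `S` over both the second subfunctor is a translate of the
first one, then `R` and `B` become isomorphic over `S`. -/
theorem nonempty_algEquiv_of_translate {n : ℕ} {F L S R B : Type u} [CommRing F] [CommRing L]
    [Algebra F L] [CommRing S] [Algebra L S] [Algebra F S] [IsScalarTower F L S]
    [CommRing R] [Algebra F R] [CommRing B] [Algebra L B]
    (X : GL (Fin n) R) (Y : GL (Fin n) B)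
    (p : ∀ (T : Type u) [CommRing T] [Algebra F T], GL (Fin n) T → Prop)
    (q : ∀ (T : Type u) [CommRing T] [Algebra L T], GL (Fin n) T → Prop)
    (hX : ∀ (T : Type u) [CommRing T] [Algebra F T] (φ : R →ₐ[F] T),
      p T (Matrix.GeneralLinearGroup.map φ.toRingHom X))
    (hX' : ∀ (T : Type u) [CommRing T] [Algebra F T] (g : GL (Fin n) T), p T g →
      ∃ φ : R →ₐ[F] T, Matrix.GeneralLinearGroup.map φ.toRingHom X = g)
    (hXext : ∀ (T : Type u) [CommRing T] [Algebra F T] (φ ψ : R →ₐ[F] T),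
      Matrix.GeneralLinearGroup.map φ.toRingHom X = Matrix.GeneralLinearGroup.map ψ.toRingHom X →
        φ = ψ)
    (hY : ∀ (T : Type u) [CommRing T] [Algebra L T] (φ : B →ₐ[L] T),
      q T (Matrix.GeneralLinearGroup.map φ.toRingHom Y))
    (hY' : ∀ (T : Type u) [CommRing T] [Algebra L T] (g : GL (Fin n) T), q T g →
      ∃ φ : B →ₐ[L] T, Matrix.GeneralLinearGroup.map φ.toRingHom Y = g)
    (hYext : ∀ (T : Type u) [CommRing T] [Algebra L T] (φ ψ : B →ₐ[L] T),
      Matrix.GeneralLinearGroup.map φ.toRingHom Y = Matrix.GeneralLinearGroup.map ψ.toRingHom Y →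
        φ = ψ)
    (h : GL (Fin n) S)
    (H : ∀ (T : Type u) [CommRing T] [Algebra S T] [Algebra L T] [Algebra F T]
      [IsScalarTower L S T] [IsScalarTower F S T] (x : GL (Fin n) T),
      q T x ↔ p T (x * (Matrix.GeneralLinearGroup.map (algebraMap S T) h)⁻¹)) :
    Nonempty (S ⊗[F] R ≃ₐ[S] S ⊗[L] B) := by
  -- The two tensor products represent functors on `S`-algebras that are identified by `x ↦ x h⁻¹`.
  -- The mutually inverse maps come from evaluating `H` at the universal points `x₁` and `X₂ h`.
  let T₁ := S ⊗[L] B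
  let T₂ := S ⊗[F] R
  let x₁ : GL (Fin n) T₁ := Matrix.GeneralLinearGroup.map
    (Algebra.TensorProduct.includeRight : B →ₐ[L] T₁).toRingHom Y
  let X₂ : GL (Fin n) T₂ := Matrix.GeneralLinearGroup.map
    (Algebra.TensorProduct.includeRight : R →ₐ[F] T₂).toRingHom X
  have hx₁ := (H T₁ x₁).mp (hY T₁
    (Algebra.TensorProduct.includeRight : B →ₐ[L] T₁))
  obtain ⟨φ, hφ⟩ := hX' T₁ _ hx₁
  have hX₂ := (H T₂ (X₂ * Matrix.GeneralLinearGroup.map (algebraMap S T₂) h)).mpr (by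
    rw [mul_inv_cancel_right]
    exact hX T₂ (Algebra.TensorProduct.includeRight : R →ₐ[F] T₂))
  obtain ⟨ψ, hψ⟩ := hY' T₂ _ hX₂
  let α : T₁ →ₐ[S] T₂ := Algebra.TensorProduct.lift (Algebra.ofId S T₂) ψ fun _ _ => .all _ _
  let β : T₂ →ₐ[S] T₁ := Algebra.TensorProduct.lift (Algebra.ofId S T₁) φ fun _ _ => .all _ _
  have hα : Matrix.GeneralLinearGroup.map α.toRingHom x₁ =
      X₂ * Matrix.GeneralLinearGroup.map (algebraMap S T₂) h := by
    rw [← hψ]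
    ext i j
    exact (Algebra.TensorProduct.lift_tmul _ _ (fun _ _ => .all _ _) _ _).trans (by simp)
  have hβ : Matrix.GeneralLinearGroup.map β.toRingHom X₂ =
      x₁ * (Matrix.GeneralLinearGroup.map (algebraMap S T₁) h)⁻¹ := by
    rw [← hφ]
    ext i j
    exact (Algebra.TensorProduct.lift_tmul _ _ (fun _ _ => .all _ _) _ _).trans (by simp)
  have hαh : Matrix.GeneralLinearGroup.map α.toRingHom
      (Matrix.GeneralLinearGroup.map (algebraMap S T₁) h) =
      Matrix.GeneralLinearGroup.map (algebraMap S T₂) h := by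
    ext i j; exact α.commutes _
  have hβh : Matrix.GeneralLinearGroup.map β.toRingHom
      (Matrix.GeneralLinearGroup.map (algebraMap S T₂) h) =
      Matrix.GeneralLinearGroup.map (algebraMap S T₁) h := by
    ext i j; exact β.commutes _
  have hβα : Matrix.GeneralLinearGroup.map β.toRingHom
      (Matrix.GeneralLinearGroup.map α.toRingHom x₁) = x₁ := by
    rw [hα, map_mul, hβ, hβh, inv_mul_cancel_right]
  have hαβ : Matrix.GeneralLinearGroup.map α.toRingHom
      (Matrix.GeneralLinearGroup.map β.toRingHom X₂) = X₂ := by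
    rw [hβ, map_mul, map_inv, hα, hαh, mul_inv_cancel_right]
  exact ⟨AlgEquiv.ofAlgHom β α
    (Algebra.TensorProduct.ext (by ext) (hYext T₁ _ _ hβα))
    (Algebra.TensorProduct.ext (by ext) (hXext T₂ _ _ hαβ))⟩

/-- If a closed subscheme of `GL_n` over a field `L` becomes, over some nonzero `L`-algebra `S`, a
translate of a smooth subgroup scheme `A`, then it is smooth and nonempty. -/
theorem ZeroLocusRing.smooth_and_nontrivial {n : ℕ} {F L S : Type u} [Field F] [Field L]
    [Algebra F L] [CommRing S] [Nontrivial S] [Algebra L S] [Algebra F S] [IsScalarTower F L S]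
    (A : ClosedSubgroupGL n F) (hA : A.IsSmooth) {κ : Type*}
    (f : κ → MvPolynomial (Fin n × Fin n) L) (h : GL (Fin n) S)
    (H : ∀ (T : Type u) [CommRing T] [Algebra S T] [Algebra L T] [Algebra F T]
      [IsScalarTower L S T] [IsScalarTower F S T] (x : GL (Fin n) T),
      (∀ i, MvPolynomial.aeval (fun p : Fin n × Fin n => x p.1 p.2) (f i) = 0) ↔
        x * (Matrix.GeneralLinearGroup.map (algebraMap S T) h)⁻¹ ∈ A.points T) :
    Algebra.Smooth L (ZeroLocusRing f) ∧ Nontrivial (ZeroLocusRing f) := by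
  obtain ⟨e⟩ := nonempty_algEquiv_of_translate A.universalPoint (point f)
    (fun T _ _ x => x ∈ A.points T)
    (fun T _ _ x => ∀ i, MvPolynomial.aeval (fun p : Fin n × Fin n => x p.1 p.2) (f i) = 0)
    (fun T _ _ φ => A.map_universalPoint_mem φ) (fun T _ _ g hg => A.exists_map_universalPoint hg)
    (fun T _ _ φ ψ h => GLCoordRing.quotient_algHom_ext h)
    (fun T _ _ φ => aeval_map_point f φ) (fun T _ _ g hg => exists_map_point f hg)
    (fun T _ _ φ ψ h => GLCoordRing.quotient_algHom_ext h) h H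
  have : Algebra.Smooth F (GLCoordRing n F ⧸ A.ideal) := hA
  have : Algebra.Smooth S (S ⊗[L] ZeroLocusRing f) := .of_equiv e
  have : Nontrivial (S ⊗[L] ZeroLocusRing f) := e.symm.toRingHom.domain_nontrivial
  -- `S` is faithfully flat over `L`, being a nonzero algebra over a field, so smoothness descends.
  refine ⟨.of_smooth_tensorProduct_of_faithfullyFlat S, ?_⟩
  by_contra hB
  rw [not_nontrivial_iff_subsingleton] at hB
  exact not_subsingleton (S ⊗[L] ZeroLocusRing f) inferInstance

/-! ### Translation-stable equations of a closed subgroup. -/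

section RightTranslate

variable {n : ℕ} {S : Type*} [CommRing S]

/-- The polynomial function `x ↦ q (x * g)` on matrices. -/
noncomputable def rightTranslate (g : Matrix (Fin n) (Fin n) S) :
    MvPolynomial (Fin n × Fin n) S →ₐ[S] MvPolynomial (Fin n × Fin n) S :=
  MvPolynomial.aeval fun p => ∑ k, MvPolynomial.C (g k p.2) * MvPolynomial.X (p.1, k)

theorem aeval_rightTranslate {T : Type*} [CommRing T] [Algebra S T]
    (x : Matrix (Fin n) (Fin n) T) (g : Matrix (Fin n) (Fin n) S)
    (q : MvPolynomial (Fin n × Fin n) S) :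
    MvPolynomial.aeval (fun p : Fin n × Fin n => x p.1 p.2) (rightTranslate g q) =
      MvPolynomial.aeval (fun p : Fin n × Fin n => (x * g.map (algebraMap S T)) p.1 p.2) q := by
  have : (MvPolynomial.aeval (R := S) (fun p : Fin n × Fin n => x p.1 p.2)).comp (rightTranslate g) =
      MvPolynomial.aeval (fun p : Fin n × Fin n => (x * g.map (algebraMap S T)) p.1 p.2) := by
    ext p
    simp [rightTranslate, Matrix.mul_apply, mul_comm]
  exact DFunLike.congr_fun this q

theorem rightTranslate_mul (g h : Matrix (Fin n) (Fin n) S)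
    (q : MvPolynomial (Fin n × Fin n) S) :
    rightTranslate (g * h) q = rightTranslate g (rightTranslate h q) := by
  have : rightTranslate (g * h) = (rightTranslate g).comp (rightTranslate h) := by
    ext p : 1
    simp only [rightTranslate, MvPolynomial.aeval_X, AlgHom.comp_apply, map_sum, map_mul,
      MvPolynomial.algHom_C, Matrix.mul_apply, Finset.sum_mul, Finset.mul_sum,
      MvPolynomial.algebraMap_eq]
    rw [Finset.sum_comm]
    simp only [mul_assoc, mul_left_comm]
  exact DFunLike.congr_fun this q

theorem rightTranslate_one (q : MvPolynomial (Fin n × Fin n) S) :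
    rightTranslate (1 : Matrix (Fin n) (Fin n) S) q = q := by
  have : rightTranslate (1 : Matrix (Fin n) (Fin n) S) = AlgHom.id S _ := by
    ext p : 1
    simp [rightTranslate, Matrix.one_apply]
  exact DFunLike.congr_fun this q

theorem map_rightTranslate {T : Type*} [CommRing T] (φ : S →+* T)
    (g : Matrix (Fin n) (Fin n) S) (q : MvPolynomial (Fin n × Fin n) S) :
    MvPolynomial.map φ (rightTranslate g q) =
      rightTranslate (g.map φ) (MvPolynomial.map φ q) := by
  have : (MvPolynomial.map φ).comp (rightTranslate g).toRingHom =
      (rightTranslate (g.map φ)).toRingHom.comp (MvPolynomial.map φ) := by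
    ext p : 2
    · simp [rightTranslate]
    · simp [rightTranslate]
  exact DFunLike.congr_fun this q

/-- Translation substitutes linear forms for the variables. The degree bound is what makes a
finite-dimensional space of equations stable. -/
theorem totalDegree_rightTranslate_le (g : Matrix (Fin n) (Fin n) S)
    (q : MvPolynomial (Fin n × Fin n) S) :
    (rightTranslate g q).totalDegree ≤ q.totalDegree := by
  have hlin : ∀ p : Fin n × Fin n, (∑ k, MvPolynomial.C (g k p.2) *
      MvPolynomial.X (R := S) (p.1, k)).totalDegree ≤ 1 := fun p =>
    MvPolynomial.totalDegree_finsetSum_le fun k _ =>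
      (MvPolynomial.totalDegree_mul _ _).trans <| by
        rw [MvPolynomial.totalDegree_C, zero_add]
        exact (MvPolynomial.totalDegree_monomial_le _ _).trans (by simp)
  rw [rightTranslate, MvPolynomial.aeval_def, MvPolynomial.eval₂_eq]
  refine MvPolynomial.totalDegree_finsetSum_le fun d hd => ?_
  refine (MvPolynomial.totalDegree_mul _ _).trans ?_
  rw [MvPolynomial.algebraMap_eq, MvPolynomial.totalDegree_C, zero_add]
  refine (MvPolynomial.totalDegree_finsetProd _ _).trans ?_
  refine le_trans (Finset.sum_le_sum fun i _ => ?_) (MvPolynomial.le_totalDegree hd)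
  exact (MvPolynomial.totalDegree_pow _ _).trans ((Nat.mul_le_mul_left _ (hlin i)).trans (by simp))

end RightTranslate

/-- Over a field `F`, the kernel of `S[X] → S ⊗ R` in bounded degree is generated by the kernel of
`F[X] → R` in bounded degree. -/
theorem MvPolynomial.mem_span_map_of_aeval_eq_zero {F S R σ : Type*} [Field F] [CommRing S]
    [Algebra F S] [CommRing R] [Algebra F R] (ρ : MvPolynomial σ F →ₐ[F] R) (D : ℕ)
    (q : MvPolynomial σ S) (hD : q.totalDegree ≤ D)
    (hq : MvPolynomial.aeval (fun i => (1 : S) ⊗ₜ[F] ρ (MvPolynomial.X i)) q = 0) :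
    q ∈ Submodule.span S (MvPolynomial.map (algebraMap F S) ''
      {p | p.totalDegree ≤ D ∧ ρ p = 0}) := by
  classical
  -- Expand `q` along an `F`-basis of `S`: the components are polynomials over `F`, and each
  -- inherits the degree bound and the vanishing under `ρ`.
  let β := Module.Basis.ofVectorSpace F S
  let e := MvPolynomial.algebraTensorAlgEquiv (σ := σ) F S
  obtain ⟨z, rfl⟩ := e.surjective q
  have hcoeff : ∀ (z : S ⊗[F] MvPolynomial σ F) κ m,
      coeff m (TensorProduct.equivFinsuppOfBasisLeft β z κ) = β.repr (coeff m (e z)) κ := by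
    intro z κ m
    induction z with
    | zero => simp
    | add x y hx hy => simp [hx, hy]
    | tmul s p =>
      rw [TensorProduct.equivFinsuppOfBasisLeft_apply_tmul_apply,
        MvPolynomial.algebraTensorAlgEquiv_tmul, MvPolynomial.coeff_smul, MvPolynomial.coeff_smul,
        MvPolynomial.coeff_map, smul_eq_mul, smul_eq_mul, mul_comm s, ← Algebra.smul_def, map_smul,
        Finsupp.smul_apply, smul_eq_mul, mul_comm]
  have hρ : ∀ (z : S ⊗[F] MvPolynomial σ F) κ,
      ρ (TensorProduct.equivFinsuppOfBasisLeft β z κ) = TensorProduct.equivFinsuppOfBasisLeft β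
        (Algebra.TensorProduct.map (AlgHom.id S S) ρ z) κ := by
    intro z κ
    induction z with
    | zero => simp
    | add x y hx hy => simp [hx, hy]
    | tmul s p => simp
  have haeval : ∀ z, MvPolynomial.aeval (fun i => (1 : S) ⊗ₜ[F] ρ (MvPolynomial.X i)) (e z) =
      Algebra.TensorProduct.map (AlgHom.id S S) ρ z := by
    intro z
    have : (MvPolynomial.aeval (R := S) (fun i => (1 : S) ⊗ₜ[F] ρ (MvPolynomial.X i))).comp
        e.toAlgHom = Algebra.TensorProduct.map (AlgHom.id S S) ρ := by
      ext
      simp [e]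
    exact DFunLike.congr_fun this z
  rw [haeval] at hq
  have hz : e z = (TensorProduct.equivFinsuppOfBasisLeft β z).sum
      fun κ p => β κ • MvPolynomial.map (algebraMap F S) p := by
    conv_lhs => rw [← (TensorProduct.equivFinsuppOfBasisLeft β).symm_apply_apply z,
      TensorProduct.equivFinsuppOfBasisLeft_symm_apply]
    simp [Finsupp.sum, e]
  rw [hz]
  refine Submodule.sum_mem _ fun κ _ => Submodule.smul_mem _ _ <| Submodule.subset_span
    (Set.mem_image_of_mem _ ⟨?_, ?_⟩)
  · refine Finset.sup_le fun m hm => ?_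
    refine (MvPolynomial.le_totalDegree (p := e z) ?_).trans hD
    rw [MvPolynomial.mem_support_iff] at hm ⊢
    intro h0
    rw [hcoeff, h0] at hm
    simp at hm
  · rw [hρ, hq]
    simp

theorem LinearIndependent.mvPolynomial_map {ι σ F S : Type*} [Field F] [CommRing S] [Algebra F S]
    {b : ι → MvPolynomial σ F} (hb : LinearIndependent F b) :
    LinearIndependent S fun i => MvPolynomial.map (algebraMap F S) (b i) := by
  rw [linearIndependent_iff']
  intro s c hc i hi
  let β := Module.Basis.ofVectorSpace F S
  apply β.repr.injective
  ext κ
  rw [map_zero, Finsupp.zero_apply]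
  refine linearIndependent_iff'.mp hb s (fun i => β.repr (c i) κ) ?_ i hi
  ext m
  have := congrArg (fun q => β.repr (MvPolynomial.coeff m q) κ) hc
  simp only [MvPolynomial.coeff_sum, MvPolynomial.coeff_smul, MvPolynomial.coeff_map, smul_eq_mul,
    mul_comm (c _), ← Algebra.smul_def, map_sum, map_smul, Finsupp.coe_finsetSum,
    Finset.sum_apply, Finsupp.smul_apply] at this
  simpa [MvPolynomial.coeff_sum, mul_comm] using this

namespace ClosedSubgroupGL

variable {n : ℕ} {F : Type u} [Field F] (A : ClosedSubgroupGL n F)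

/-- The restriction of polynomial functions on matrices to `A`. -/
noncomputable def restrictPoly :
    MvPolynomial (Fin n × Fin n) F →ₐ[F] GLCoordRing n F ⧸ A.ideal :=
  (Ideal.Quotient.mkₐ F A.ideal).comp (IsScalarTower.toAlgHom F _ (GLCoordRing n F))

theorem aeval_eq_zero_of_restrictPoly_eq_zero {S : Type u} [CommRing S] [Algebra F S]
    {g : GL (Fin n) S} (hg : g ∈ A.points S) {p : MvPolynomial (Fin n × Fin n) F}
    (hp : A.restrictPoly p = 0) :
    MvPolynomial.aeval (fun p : Fin n × Fin n => g p.1 p.2) p = 0 := by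
  rw [← evalGL_algebraMap]
  exact hg _ (Ideal.Quotient.eq_zero_iff_mem.mp hp)

/-- The translate of `p` by `a`, evaluated at `X` over `S ⊗ R`, is the value of `p` at `X a`, which
is again a point of `A`. -/
theorem rightTranslate_map_mem_span {S R : Type u} [CommRing S] [Algebra F S] [CommRing R]
    [Algebra F R] (ρ : MvPolynomial (Fin n × Fin n) F →ₐ[F] R) (X : GL (Fin n) R)
    (hρ : ∀ i j, ρ (MvPolynomial.X (i, j)) = X i j)
    (hX : ∀ (T : Type u) [CommRing T] [Algebra F T] (φ : R →ₐ[F] T),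
      Matrix.GeneralLinearGroup.map φ.toRingHom X ∈ A.points T)
    {a : GL (Fin n) S} (ha : a ∈ A.points S) {D : ℕ} {p : MvPolynomial (Fin n × Fin n) F}
    (hD : p.totalDegree ≤ D)
    (hp : ∀ (T : Type u) [CommRing T] [Algebra F T], ∀ g ∈ A.points T,
      MvPolynomial.aeval (fun p : Fin n × Fin n => g p.1 p.2) p = 0) :
    rightTranslate a.1 (MvPolynomial.map (algebraMap F S) p) ∈ Submodule.span S
      (MvPolynomial.map (algebraMap F S) '' {p | p.totalDegree ≤ D ∧ ρ p = 0}) := by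
  refine MvPolynomial.mem_span_map_of_aeval_eq_zero ρ D _ ?_ ?_
  · refine (totalDegree_rightTranslate_le _ _).trans (le_trans ?_ hD)
    exact Finset.sup_mono (MvPolynomial.support_map_subset _ _)
  have hρ' : (fun i => (1 : S) ⊗ₜ[F] ρ (MvPolynomial.X i)) =
      fun p : Fin n × Fin n => (1 : S) ⊗ₜ[F] X p.1 p.2 := funext fun p => by rw [← hρ]
  rw [hρ']
  let x : GL (Fin n) (S ⊗[F] R) := Matrix.GeneralLinearGroup.map
    (Algebra.TensorProduct.includeRight : R →ₐ[F] S ⊗[F] R).toRingHom X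
  let a' := A.pointsMap (Algebra.TensorProduct.includeLeft : S →ₐ[F] S ⊗[F] R) ⟨a, ha⟩
  have := hp _ _ ((A.points _).mul_mem (hX _ Algebra.TensorProduct.includeRight) a'.2)
  rw [← MvPolynomial.aeval_map_algebraMap S] at this
  exact (aeval_rightTranslate x.1 a.1 _).trans this

/-- A closed subgroup scheme of `GL_n` is cut out by finitely many linearly independent polynomials
whose span is stable under right translations by points of the subgroup. -/
theorem exists_stable_equations : ∃ (d : ℕ) (b : Fin d → MvPolynomial (Fin n × Fin n) F),
    LinearIndependent F b ∧
    (∀ (S : Type u) [CommRing S] [Algebra F S] (g : GL (Fin n) S), g ∈ A.points S ↔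
      ∀ i, MvPolynomial.aeval (fun p : Fin n × Fin n => g p.1 p.2) (b i) = 0) ∧
    ∀ (S : Type u) [CommRing S] [Algebra F S] (a : GL (Fin n) S), a ∈ A.points S → ∀ i,
      rightTranslate a.1 (MvPolynomial.map (algebraMap F S) (b i)) ∈
        Submodule.span S (Set.range fun j => MvPolynomial.map (algebraMap F S) (b j)) := by
  let J : Ideal (MvPolynomial (Fin n × Fin n) F) := RingHom.ker A.restrictPoly
  obtain ⟨s, hs⟩ : J.FG := IsNoetherian.noetherian J
  -- `D` bounds the degrees of generators of `J`, so the finite-dimensional space `N` generates `J`.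
  let D := s.sup MvPolynomial.totalDegree
  let N : Submodule F (MvPolynomial (Fin n × Fin n) F) :=
    MvPolynomial.restrictTotalDegree (Fin n × Fin n) F D ⊓ J.restrictScalars F
  have hN : ∀ p, p ∈ N ↔ p.totalDegree ≤ D ∧ A.restrictPoly p = 0 := fun p => by
    rw [Submodule.mem_inf, MvPolynomial.mem_restrictTotalDegree]
    rfl
  have : Module.Finite F N :=
    Module.Finite.of_injective (Submodule.inclusion inf_le_left) (Submodule.inclusion_injective _)
  let b := Module.finBasis F N
  have hb : ∀ i, (b i).1.totalDegree ≤ D ∧ A.restrictPoly (b i).1 = 0 := fun i => (hN _).mp (b i).2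
  refine ⟨_, fun i => (b i).1, b.linearIndependent.map' N.subtype N.ker_subtype, ?_, ?_⟩
  · intro S _ _ g
    refine ⟨fun hg i => A.aeval_eq_zero_of_restrictPoly_eq_zero hg (hb i).2, fun hg => ?_⟩
    have hNg : N ≤ LinearMap.ker
        (MvPolynomial.aeval (R := F) fun p : Fin n × Fin n => g p.1 p.2).toLinearMap := by
      rw [← Submodule.range_subtype N, ← Submodule.map_top, ← b.span_eq, Submodule.map_span,
        Submodule.span_le]
      rintro _ ⟨_, ⟨i, rfl⟩, rfl⟩
      exact hg i
    have hJ : J ≤ RingHom.ker (MvPolynomial.aeval (R := F) fun p : Fin n × Fin n => g p.1 p.2) := by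
      rw [← hs, Ideal.span_le]
      intro p hp
      exact hNg ((hN p).mpr ⟨Finset.le_sup hp, by
        have : p ∈ J := hs ▸ Ideal.subset_span hp
        exact this⟩)
    -- An ideal of a localization is generated by its contraction, here `J`.
    have hI : A.ideal ≤ RingHom.ker (evalGL g : GLCoordRing n F →ₐ[F] S) := by
      rw [← IsLocalization.map_under
        (Submonoid.powers (Matrix.mvPolynomialX (Fin n) (Fin n) F).det) _ A.ideal,
        Ideal.map_le_iff_le_comap]
      intro p hp
      have hp' : p ∈ J := Ideal.Quotient.eq_zero_iff_mem.mpr hp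
      exact (evalGL_algebraMap g p).trans (hJ hp')
    exact fun f hf => hI hf
  · intro S _ _ a ha i
    have hle : Submodule.span S (MvPolynomial.map (algebraMap F S) ''
        {p | p.totalDegree ≤ D ∧ A.restrictPoly p = 0}) ≤
        Submodule.span S (Set.range fun j => MvPolynomial.map (algebraMap F S) (b j).1) := by
      rw [Submodule.span_le]
      rintro _ ⟨p, hp, rfl⟩
      have := congrArg (fun q => MvPolynomial.map (algebraMap F S) q.1)
        (b.sum_repr ⟨p, (hN p).mpr hp⟩)
      simp only [Submodule.coe_sum, Submodule.coe_smul, map_sum, MvPolynomial.smul_eq_C_mul,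
        map_mul, MvPolynomial.map_C] at this
      rw [← this]
      refine Submodule.sum_mem _ fun j _ => ?_
      rw [← MvPolynomial.smul_eq_C_mul]
      exact Submodule.smul_mem _ _ (Submodule.subset_span ⟨j, rfl⟩)
    exact hle (A.rightTranslate_map_mem_span A.restrictPoly A.universalPoint (fun i j => rfl)
      (fun T _ _ φ => A.map_universalPoint_mem φ) ha (hb i).1 fun T _ _ g hg =>
        A.aeval_eq_zero_of_restrictPoly_eq_zero hg (hb i).2)

/-- The matrices of right translations by points of a closed subgroup scheme are invertible. -/
theorem exists_GL_rightTranslate {d : ℕ} {b : Fin d → MvPolynomial (Fin n × Fin n) F}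
    (hb : LinearIndependent F b) {S : Type u} [CommRing S] [Algebra F S]
    (hstab : ∀ a ∈ A.points S, ∀ i,
      rightTranslate a.1 (MvPolynomial.map (algebraMap F S) (b i)) ∈
        Submodule.span S (Set.range fun j => MvPolynomial.map (algebraMap F S) (b j)))
    {a : GL (Fin n) S} (ha : a ∈ A.points S) :
    ∃ G : GL (Fin d) S, ∀ i, rightTranslate a.1 (MvPolynomial.map (algebraMap F S) (b i)) =
      ∑ j, G j i • MvPolynomial.map (algebraMap F S) (b j) := by
  choose! c hc using fun a ha i => Submodule.mem_span_range_iff_exists_fun S |>.mp (hstab a ha i)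
  let G (a : GL (Fin n) S) : Matrix (Fin d) (Fin d) S := .of fun j i => c a i j
  have hli := hb.mvPolynomial_map (S := S)
  -- Translating by `a⁻¹` and then by `a` is the identity, and coefficients are unique since the
  -- equations stay independent over `S`.
  have hmul : ∀ a ∈ A.points S, G a * G a⁻¹ = 1 := by
    intro a ha
    ext k i
    refine hli.eq_coords_of_eq (f := fun k => (G a * G a⁻¹) k i)
      (g := fun k => (1 : Matrix (Fin d) (Fin d) S) k i) ?_ k
    have h₁ : rightTranslate a.1 (rightTranslate a⁻¹.1 (MvPolynomial.map (algebraMap F S) (b i))) =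
        MvPolynomial.map (algebraMap F S) (b i) := by
      rw [← rightTranslate_mul, Units.mul_inv, rightTranslate_one]
    rw [← hc a⁻¹ ((A.points S).inv_mem ha)] at h₁
    simp only [map_sum, map_smul, ← hc a ha] at h₁
    simp only [Matrix.mul_apply, Finset.sum_smul, Matrix.one_apply, ite_smul, one_smul, zero_smul,
      Finset.sum_ite_eq', Finset.mem_univ, if_true]
    rw [Finset.sum_comm, ← h₁]
    simp only [Finset.smul_sum, smul_smul, G, Matrix.of_apply, mul_comm]
  exact ⟨⟨G a, G a⁻¹, hmul a ha, by simpa using hmul a⁻¹ ((A.points S).inv_mem ha)⟩,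
    fun i => (hc a ha i).symm⟩

end ClosedSubgroupGL

/-- `MvPolynomial.map` as a semilinear map. -/
noncomputable def MvPolynomial.mapSemilinear {S T : Type*} [CommRing S] [CommRing T] (φ : S →+* T)
    (σ : Type*) : MvPolynomial σ S →ₛₗ[φ] MvPolynomial σ T where
  toFun := MvPolynomial.map φ
  map_add' := map_add _
  map_smul' a p := by simp [MvPolynomial.smul_eq_C_mul]

@[simp]
theorem MvPolynomial.mapSemilinear_apply {S T : Type*} [CommRing S] [CommRing T] (φ : S →+* T)
    {σ : Type*} (p : MvPolynomial σ S) : mapSemilinear φ σ p = map φ p := rfl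

namespace GammaOverField

variable {V : Type w₁} {E : Type w₂} {Γ : LooplessMultigraph V E} {F : Type u} [Field F]
  (K : GammaOverField Γ F) (o : Γ.Orientation)

/-- Compatible families of polynomials over the `F_v ⊗_F S` come from a polynomial over `S`. -/
theorem exists_map_eq_mvPolynomial [Nonempty V] {S : Type*} [CommRing S] [Algebra F S] {σ : Type*}
    (q : ∀ v, MvPolynomial σ (K.vfield v ⊗[F] S))
    (hq : ∀ e, MvPolynomial.map (K.ιBase S (o.left_mem e)).toRingHom (q (o.left e)) =
      MvPolynomial.map (K.ιBase S (o.right_mem e)).toRingHom (q (o.right e))) :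
    ∃ f : MvPolynomial σ S, ∀ v, MvPolynomial.map
      (Algebra.TensorProduct.includeRight : S →ₐ[F] K.vfield v ⊗[F] S).toRingHom f = q v := by
  choose c hc using fun m => K.exists_one_tmul_eq o (fun v => MvPolynomial.coeff m (q v))
    fun e => by
      have := congrArg (MvPolynomial.coeff m) (hq e)
      rw [MvPolynomial.coeff_map, MvPolynomial.coeff_map] at this
      exact this
  obtain ⟨v₀⟩ := ‹Nonempty V›
  refine ⟨∑ m ∈ (q v₀).support, MvPolynomial.monomial m (c m), fun v => ?_⟩
  classical
  -- Outside the support at `v₀` the coefficient `c m` vanishes by injectivity of `S → F_v₀ ⊗ S`.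
  have hcoeff : ∀ m, MvPolynomial.coeff m
      (∑ m ∈ (q v₀).support, MvPolynomial.monomial m (c m)) = c m := fun m => by
    simp only [MvPolynomial.coeff_sum, MvPolynomial.coeff_monomial, Finset.sum_ite_eq']
    rw [ite_eq_left_iff, MvPolynomial.notMem_support_iff, hc]
    exact fun h => (K.tmul_one_injective v₀ (h.trans (TensorProduct.tmul_zero _ _).symm)).symm
  ext m
  rw [MvPolynomial.coeff_map, hcoeff, hc]
  rfl

end GammaOverField

/-- Vanishing of linear combinations of polynomials with an invertible matrix of coefficients. -/
theorem forall_sum_smul_eq_zero_iff {d : ℕ} {S M : Type*} [CommRing S] [AddCommGroup M] [Module S M]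
    (k : GL (Fin d) S) (y : Fin d → M) :
    (∀ i, ∑ j, k j i • y j = 0) ↔ ∀ j, y j = 0 := by
  refine ⟨fun h m => ?_, fun h i => by simp [h]⟩
  have h₁ : ∑ i, k⁻¹ i m • ∑ j, k j i • y j = y m := by
    simp only [Finset.smul_sum, smul_smul]
    rw [Finset.sum_comm]
    have : ∀ j, ∑ i, k⁻¹ i m * k j i = (1 : Matrix (Fin d) (Fin d) S) j m := fun j => by
      rw [← Units.mul_inv k, Matrix.mul_apply]
      simp only [mul_comm]
    simp_rw [← Finset.sum_smul, this]
    simp [Matrix.one_apply]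
  rw [← h₁]
  simp [h]

/-! ### Factorization in smooth groups over a separably closed extension. -/

namespace ClosedSubgroupGL

variable {V : Type w₁} {E : Type w₂} {Γ : LooplessMultigraph V E} {n : ℕ} {F : Type u} [Field F]
  (A : ClosedSubgroupGL n F) (K : GammaOverField Γ F) (o : Γ.Orientation)

/-- If the general linear groups factor over a separably closed extension, so does every smooth
closed subgroup scheme. -/
theorem exists_factorization_of_glFactors [Nonempty V] (L : Type u) [Field L] [Algebra F L]
    [IsSepClosed L]
    (H : ∀ n, GLFactors (R := fun v => K.vfield v ⊗[F] L) (Q := fun e => K.efield e ⊗[F] L)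
      (fun e => (K.ιBase L (o.left_mem e)).toRingHom)
      (fun e => (K.ιBase L (o.right_mem e)).toRingHom) n)
    (hA : A.IsSmooth) (g : ∀ e, A.points (K.efield e ⊗[F] L)) :
    ∃ a : ∀ v, A.points (K.vfield v ⊗[F] L), ∀ e,
      Matrix.GeneralLinearGroup.map (K.ιBase L (o.left_mem e)).toRingHom (a (o.left e)).1 =
        (g e).1 * Matrix.GeneralLinearGroup.map (K.ιBase L (o.right_mem e)).toRingHom
          (a (o.right e)).1 := by
  obtain ⟨d, b, hb, hAb, hstab⟩ := A.exists_stable_equations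
  obtain ⟨h, hh⟩ := H n fun e => (g e).1
  choose G hG using fun e => A.exists_GL_rightTranslate hb (hstab (K.efield e ⊗[F] L)) (g e).2
  -- The equations `b_i (x h_v⁻¹)` of the coset `A h_v`.
  let u v (i : Fin d) : MvPolynomial (Fin n × Fin n) (K.vfield v ⊗[F] L) :=
    rightTranslate (h v)⁻¹.1 (MvPolynomial.map (algebraMap F _) (b i))
  have hu : ∀ {v e} (hv : v ∈ Γ.ends e) i, MvPolynomial.map (K.ιBase L hv).toRingHom (u v i) =
      rightTranslate (Matrix.GeneralLinearGroup.map (K.ιBase L hv).toRingHom (h v))⁻¹.1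
        (MvPolynomial.map (algebraMap F _) (b i)) := fun {v e} hv i => by
    rw [map_rightTranslate, MvPolynomial.map_map, ← map_inv]
    exact congrArg (fun φ => rightTranslate _ (MvPolynomial.map φ (b i)))
      (K.ιBase L hv).comp_algebraMap
  -- At an edge `h_r⁻¹ = h_l⁻¹ g`, so the two systems of equations differ by the matrix `G e` of
  -- translation by `g e`. Factoring the `G e` in `GL_d` makes the systems equal at the edges.
  obtain ⟨k, hk⟩ := (H d).exists_compatible_families
    (fun e => MvPolynomial.mapSemilinear (K.ιBase L (o.left_mem e)).toRingHom (Fin n × Fin n))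
    (fun e => MvPolynomial.mapSemilinear (K.ιBase L (o.right_mem e)).toRingHom (Fin n × Fin n))
    u G fun e i => by
      simp only [MvPolynomial.mapSemilinear_apply, hu, ← map_smul, ← map_sum, ← hG]
      rw [← rightTranslate_mul, hh, mul_inv_rev, Units.val_mul, mul_assoc, Units.inv_mul, mul_one]
  choose f hf using fun i => K.exists_map_eq_mvPolynomial o
    (fun v => ∑ j, k v j i • u v j) fun e => hk e i
  let _ : ∀ v, Algebra L (K.vfield v ⊗[F] L) := fun v => Algebra.TensorProduct.rightAlgebra
  have hpt : ∀ v (T : Type u) [CommRing T] [Algebra (K.vfield v ⊗[F] L) T] [Algebra L T]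
      [Algebra F T] [IsScalarTower L (K.vfield v ⊗[F] L) T]
      [IsScalarTower F (K.vfield v ⊗[F] L) T] (x : GL (Fin n) T),
      (∀ i, MvPolynomial.aeval (fun p : Fin n × Fin n => x p.1 p.2) (f i) = 0) ↔
        x * (Matrix.GeneralLinearGroup.map (algebraMap (K.vfield v ⊗[F] L) T) (h v))⁻¹ ∈
          A.points T := by
    intro v T _ _ _ _ _ _ x
    rw [hAb]
    refine Iff.trans (forall_congr' fun i => ?_) (forall_sum_smul_eq_zero_iff
      (Matrix.GeneralLinearGroup.map (algebraMap (K.vfield v ⊗[F] L) T) (k v)) _)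
    have h₁ : MvPolynomial.map (algebraMap L (K.vfield v ⊗[F] L)) (f i) = _ := hf i v
    rw [← MvPolynomial.aeval_map_algebraMap (K.vfield v ⊗[F] L), h₁, map_sum]
    simp only [map_smul, u, aeval_rightTranslate]
    rw [← map_inv]
    simp only [MvPolynomial.aeval_map_algebraMap,
      Algebra.smul_def (R := K.vfield v ⊗[F] L) (A := T)]
    rfl
  -- One vertex suffices to see that the glued scheme is smooth and nonempty.
  obtain ⟨v₀⟩ := ‹Nonempty V›
  obtain ⟨_, _⟩ := ZeroLocusRing.smooth_and_nontrivial A hA f (h v₀) (hpt v₀)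
  obtain ⟨φ⟩ := Algebra.Smooth.nonempty_algHom_of_isSepClosed L (ZeroLocusRing f)
  let x : GL (Fin n) L := Matrix.GeneralLinearGroup.map φ.toRingHom (ZeroLocusRing.point f)
  have hx : ∀ v, Matrix.GeneralLinearGroup.map (algebraMap L (K.vfield v ⊗[F] L)) x * (h v)⁻¹ ∈
      A.points (K.vfield v ⊗[F] L) := fun v => by
    refine (hpt v _ _).mp fun i => ?_
    exact ZeroLocusRing.aeval_map_point f ((Algebra.ofId L (K.vfield v ⊗[F] L)).comp φ) i
  -- The factors are `h_v x⁻¹`. As `x` is defined over `L`, its images from both vertices of an edge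
  -- coincide, and `h_l x⁻¹ = g h_r x⁻¹`.
  refine ⟨fun v => ⟨_, (A.points _).inv_mem (hx v)⟩, fun e => ?_⟩
  have hxe : ∀ {v} (hv : v ∈ Γ.ends e), Matrix.GeneralLinearGroup.map (K.ιBase L hv).toRingHom
      (Matrix.GeneralLinearGroup.map (algebraMap L (K.vfield v ⊗[F] L)) x) =
      Matrix.GeneralLinearGroup.map (Algebra.TensorProduct.includeRight :
        L →ₐ[F] K.efield e ⊗[F] L).toRingHom x := fun hv => by
    ext i j
    simp [RingHom.algebraMap_toAlgebra]
  simp only [mul_inv_rev, inv_inv, map_mul, map_inv, hxe, hh, mul_assoc]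

end ClosedSubgroupGL

/-! ### Patching of vector spaces. -/

theorem IsBaseChangeAlong.exists_basis {R S : Type*} [CommRing R] [CommRing S] {f : R →+* S}
    {M N : Type*} [AddCommGroup M] [Module R M] [AddCommGroup N] [Module S N] {φ : M →ₛₗ[f] N}
    (h : IsBaseChangeAlong f φ) {ι : Type*} (b : Module.Basis ι R M) :
    ∃ c : Module.Basis ι S N, ∀ i, c i = φ (b i) := by
  let : Algebra R S := f.toAlgebra
  let : Module R N := Module.compHom N f
  have : IsScalarTower R S N := ⟨fun r s n => mul_smul (f r) s n⟩
  exact ⟨IsBaseChange.basis b h, fun i => IsBaseChange.basis_apply b h i⟩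

theorem isBaseChangeAlong_of_basis {R S : Type*} [CommRing R] [CommRing S] {f : R →+* S}
    {M N : Type*} [AddCommGroup M] [Module R M] [AddCommGroup N] [Module S N] {φ : M →ₛₗ[f] N}
    {ι : Type*} (b : Module.Basis ι R M) (c : Module.Basis ι S N) (h : ∀ i, c i = φ (b i)) :
    IsBaseChangeAlong f φ := by
  let : Algebra R S := f.toAlgebra
  let : Module R N := Module.compHom N f
  have : IsScalarTower R S N := ⟨fun r s n => mul_smul (f r) s n⟩
  let ψ : M →ₗ[R] N := { toFun := φ, map_add' := φ.map_add, map_smul' := φ.map_smulₛₗ }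
  let e : S ⊗[R] M ≃ₗ[S] N := (b.baseChange S).equiv c (Equiv.refl ι)
  have he : e.toLinearMap = (ψ.liftBaseChange S) := by
    refine (b.baseChange S).ext fun i => ?_
    rw [LinearEquiv.coe_coe, Module.Basis.equiv_apply, Module.Basis.baseChange_apply,
      LinearMap.liftBaseChange_tmul, one_smul]
    exact h i
  refine IsBaseChange.of_equiv e fun x => ?_
  rw [← LinearEquiv.coe_coe, he, LinearMap.liftBaseChange_tmul, one_smul]

namespace PatchingProblem

variable {V : Type w₁} {E : Type w₂} {Γ : LooplessMultigraph V E} {K : GammaField.{u} Γ}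

/-- A morphism of patching problems which is bijective at all vertices and edges is an
isomorphism. -/
def isoOfEquiv {P Q : PatchingProblem K} (a : ∀ v, P.vspace v ≃ₗ[K.vfield v] Q.vspace v)
    (b : ∀ e, P.espace e ≃ₗ[K.efield e] Q.espace e)
    (comm : ∀ {v : V} {e : E} (h : v ∈ Γ.ends e) (x : P.vspace v),
      Q.φ h (a v x) = b e (P.φ h x)) : P ≅ Q where
  hom := Hom.mk (fun v => (a v).toLinearMap) (fun e => (b e).toLinearMap) comm
  inv := Hom.mk (fun v => (a v).symm.toLinearMap) (fun e => (b e).symm.toLinearMap) fun h x => by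
    rw [LinearEquiv.coe_coe, LinearEquiv.coe_coe, LinearEquiv.eq_symm_apply, ← comm,
      LinearEquiv.apply_symm_apply]
  hom_inv_id := Hom.ext (funext fun v => by ext x; exact (a v).symm_apply_apply x)
    (funext fun e => by ext x; exact (b e).symm_apply_apply x)
  inv_hom_id := Hom.ext (funext fun v => by ext x; exact (a v).apply_symm_apply x)
    (funext fun e => by ext x; exact (b e).apply_symm_apply x)

/-- The linear equivalence at a vertex underlying an isomorphism of patching problems. -/
def vequivOfIso {P Q : PatchingProblem K} (i : P ≅ Q) (v : V) :
    P.vspace v ≃ₗ[K.vfield v] Q.vspace v :=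
  .ofLinearMap (i.hom.vhom v) (i.inv.vhom v)
    (congrArg (fun f : Hom Q Q => f.vhom v) i.inv_hom_id)
    (congrArg (fun f : Hom P P => f.vhom v) i.hom_inv_id)

theorem finrank_vspace_eq_finrank_espace (P : PatchingProblem K) {v : V} {e : E}
    (h : v ∈ Γ.ends e) : Module.finrank (K.vfield v) (P.vspace v) =
      Module.finrank (K.efield e) (P.espace e) := by
  obtain ⟨c, -⟩ := (P.isBaseChange h).exists_basis (Module.finBasis (K.vfield v) (P.vspace v))
  rw [Module.finrank_eq_card_basis c, Fintype.card_fin]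

/-- Ranks agree across an edge, hence along paths; a constant rank is needed to apply a single
`GL_n`. -/
theorem finrank_vspace_eq (P : PatchingProblem K) (hΓ : Γ.Connected) (v w : V) :
    Module.finrank (K.vfield v) (P.vspace v) = Module.finrank (K.vfield w) (P.vspace w) := by
  obtain ⟨p⟩ := hΓ.preconnected v w
  induction p with
  | nil => rfl
  | cons h _ ih =>
    obtain ⟨e, he⟩ := h
    rw [← ih, P.finrank_vspace_eq_finrank_espace (e := e) (he ▸ Sym2.mem_mk_left _ _),
      P.finrank_vspace_eq_finrank_espace (e := e) (he ▸ Sym2.mem_mk_right _ _)]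

end PatchingProblem

section

variable {V : Type w₁} {E : Type w₂} {Γ : LooplessMultigraph V E} {F : Type u} [Field F]
  (K : GammaOverField Γ F) (o : Γ.Orientation)

theorem faithful_baseChange [Nonempty V] : (baseChange K).Faithful where
  map_injective {W W'} f g h := by
    obtain ⟨v⟩ := ‹Nonempty V›
    ext w
    apply K.tmul_one_injective v
    have := congrArg (fun f : PatchingProblem.Hom _ _ => f.vhom v (1 ⊗ₜ w)) h
    exact this

theorem transition_one_tmul (W : Type u) [AddCommGroup W] [Module F W] {v : V} {e : E}
    (h : v ∈ Γ.ends e) (w : W) : K.transition W h (1 ⊗ₜ w) = 1 ⊗ₜ w := by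
  simp [GammaOverField.transition]

include o in
-- The images of `1 ⊗ w` under a morphism form a compatible family, so they come from a unique
-- vector of `W'`.
theorem full_baseChange [Nonempty V] : (baseChange K).Full where
  map_surjective {W W'} f := by
    let fv v : K.vfield v ⊗[F] W →ₗ[K.vfield v] K.vfield v ⊗[F] W' := f.vhom v
    let fe e : K.efield e ⊗[F] W →ₗ[K.efield e] K.efield e ⊗[F] W' := f.ehom e
    have comm : ∀ {v : V} {e : E} (h : v ∈ Γ.ends e) (w : W),
        K.transition W' h (fv v (1 ⊗ₜ[F] w)) = fe e (1 ⊗ₜ[F] w) := fun {v e} h w =>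
      (f.comm h (1 ⊗ₜ[F] w)).trans (congrArg (fe e) (transition_one_tmul K W h w))
    choose m hm using fun w : W => K.exists_one_tmul_eq o (M := W')
      (fun v => fv v (1 ⊗ₜ[F] w)) fun e => (comm _ w).trans (comm _ w).symm
    have inj : ∀ {x y : W'}, (∀ v, (1 : K.vfield v) ⊗ₜ[F] x = 1 ⊗ₜ[F] y) → x = y := by
      obtain ⟨v₀⟩ := ‹Nonempty V›
      exact fun h => K.tmul_one_injective v₀ (h v₀)
    let m' : W →ₗ[F] W' :=
      { toFun := m
        map_add' := fun x y => inj fun v => by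
          simp only [← hm, TensorProduct.tmul_add, map_add]
        map_smul' := fun c x => inj fun v => by
          simp only [← hm, TensorProduct.tmul_smul, RingHom.id_apply]
          exact LinearMap.map_smul_of_tower (fv v) c _ }
    have hfv : ∀ v, m'.baseChange (K.vfield v) = fv v := fun v => by
      refine TensorProduct.AlgebraTensorModule.curry_injective ?_
      ext w
      exact (hm w v).symm
    have hfe : ∀ e, m'.baseChange (K.efield e) = fe e := fun e => by
      refine TensorProduct.AlgebraTensorModule.curry_injective ?_
      ext w
      refine Eq.trans ?_ (comm (o.left_mem e) w)
      rw [hm, transition_one_tmul]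
      rfl
    exact ⟨FGModuleCat.ofHom m', PatchingProblem.Hom.ext (funext hfv) (funext hfe)⟩

/-- Factorization turns arbitrary vertex bases into compatible ones, which identify `P` with the
base change of `F^n`. -/
theorem essSurj_baseChange (hΓ : Γ.Connected)
    (H : ∀ n, GLFactors (R := K.vfield) (Q := K.efield) (fun e => K.ι (o.left_mem e))
      (fun e => K.ι (o.right_mem e)) n) : (baseChange K).EssSurj where
  mem_essImage P := by
    obtain ⟨v₀⟩ := hΓ.nonempty
    let n := Module.finrank (K.vfield v₀) (P.vspace v₀)
    have hP : ∀ {v : V} {e : E} (h : v ∈ Γ.ends e) (b : Module.Basis (Fin n) _ (P.vspace v)),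
      ∃ c : Module.Basis (Fin n) (K.efield e) (P.espace e), ∀ i, c i = P.φ h (b i) :=
      fun h b => (P.isBaseChange h).exists_basis b
    obtain ⟨b, b', hb, hb'⟩ := GLFactors.exists_compatible_bases H
      (fun e => P.φ (o.left_mem e)) (fun e => P.φ (o.right_mem e))
      (fun v => Module.finBasisOfFinrankEq (K.vfield v) (P.vspace v) (P.finrank_vspace_eq hΓ v v₀))
      (fun e => hP _ _) (fun e => hP _ _)
    have hbb' : ∀ {v : V} {e : E} (h : v ∈ Γ.ends e) i, P.φ h (b v i) = b' e i := by
      intro v e h i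
      have h' := h
      rw [o.ends_eq, Sym2.mem_iff] at h'
      rcases h' with rfl | rfl
      exacts [hb e i, hb' e i]
    let β := Pi.basisFun F (Fin n)
    refine ⟨FGModuleCat.of F (Fin n → F), ⟨PatchingProblem.isoOfEquiv
      (fun v => (β.baseChange (K.vfield v)).equiv (b v) (Equiv.refl _))
      (fun e => (β.baseChange (K.efield e)).equiv (b' e) (Equiv.refl _)) ?_⟩⟩
    intro v e h x
    have : (P.φ h).comp ((β.baseChange (K.vfield v)).equiv (b v) (Equiv.refl _)).toLinearMap =
        ((β.baseChange (K.efield e)).equiv (b' e) (Equiv.refl _)).toLinearMap.comp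
          (K.transition (Fin n → F) h) := by
      refine (β.baseChange (K.vfield v)).ext fun i => ?_
      have h₁ : K.transition (Fin n → F) h (β.baseChange (K.vfield v) i) =
          β.baseChange (K.efield e) i := by
        rw [Module.Basis.baseChange_apply, Module.Basis.baseChange_apply, transition_one_tmul]
      rw [LinearMap.comp_apply, LinearMap.comp_apply, h₁, LinearEquiv.coe_coe, LinearEquiv.coe_coe,
        Module.Basis.equiv_apply, Module.Basis.equiv_apply]
      exact hbb' h i
    exact DFunLike.congr_fun this x

theorem LooplessMultigraph.Orientation.left_ne_right (e : E) : o.left e ≠ o.right e := fun h =>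
  Γ.not_isDiag e (by rw [o.ends_eq, h]; exact Sym2.mk_isDiag_iff.mpr rfl)

open Classical in
/-- The patching problem with trivial vector spaces of dimension `n` whose transition maps at the
right vertices are given by matrices. -/
noncomputable def PatchingProblem.ofMatrices {n : ℕ} (g : ∀ e, GL (Fin n) (K.efield e)) :
    PatchingProblem K.toGammaField where
  vspace v := Fin n → K.vfield v
  espace e := Fin n → K.efield e
  φ {v e} h :=
    { toFun := fun x => (if v = o.left e then 1 else g e : GL (Fin n) (K.efield e)).1.mulVec
        (K.ι h ∘ x)
      map_add' := fun x y => by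
        rw [← Matrix.mulVec_add]
        congr 1
        ext i
        simp
      map_smul' := fun c x => by
        rw [← Matrix.mulVec_smul]
        congr 1
        ext i
        simp }
  isBaseChange {v e} h := by
    let G : GL (Fin n) (K.efield e) := if v = o.left e then 1 else g e
    refine isBaseChangeAlong_of_basis (Pi.basisFun (K.vfield v) (Fin n))
      ((Pi.basisFun (K.efield e) (Fin n)).map (Matrix.toLin'OfInv G.inv_mul G.mul_inv))
      fun i => ?_
    change Matrix.toLin' G.1 _ = G.1.mulVec _
    rw [Matrix.toLin'_apply]
    congr 1
    ext j
    by_cases hj : j = i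
    · subst hj; simp
    · simp [hj]

/-- The problem glued by the `g e` comes from some `W`. The images of a basis of `W` at the vertices
are the columns of the factors. -/
theorem glFactors_of_essSurj [Nonempty V] [(baseChange K).EssSurj] (n : ℕ) :
    GLFactors (R := K.vfield) (Q := K.efield) (fun e => K.ι (o.left_mem e))
      (fun e => K.ι (o.right_mem e)) n := by
  classical
  intro g
  let P := PatchingProblem.ofMatrices K o g
  let W := (baseChange K).objPreimage P
  let i : (baseChange K).obj W ≅ P := (baseChange K).objObjPreimageIso P
  let τ v : K.vfield v ⊗[F] W ≃ₗ[K.vfield v] (Fin n → K.vfield v) :=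
    PatchingProblem.vequivOfIso i v
  let τe e : K.efield e ⊗[F] W →ₗ[K.efield e] (Fin n → K.efield e) := i.hom.ehom e
  have hrank : Module.finrank F W = n := by
    obtain ⟨v⟩ := ‹Nonempty V›
    rw [← Module.finrank_baseChange (R := K.vfield v), (τ v).finrank_eq]
    simp
  let β := Module.finBasisOfFinrankEq F W hrank
  have hcomm : ∀ {v e} (h : v ∈ Γ.ends e) w, P.φ h (τ v (1 ⊗ₜ w)) = τe e (1 ⊗ₜ w) :=
    fun {v e} h w => (i.hom.comm h (1 ⊗ₜ[F] w)).trans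
      (congrArg (τe e) (transition_one_tmul K W h w))
  let H v : Matrix (Fin n) (Fin n) (K.vfield v) := .of fun a j => τ v (1 ⊗ₜ β j) a
  have hunit : ∀ v, IsUnit (H v) := fun v => by
    have : H v = (Pi.basisFun (K.vfield v) (Fin n)).toMatrix
        ((β.baseChange (K.vfield v)).map (τ v)) := by
      ext a j
      simp [H, Module.Basis.toMatrix_apply]
    rw [this]
    exact ⟨⟨_, ((β.baseChange (K.vfield v)).map (τ v)).toMatrix (Pi.basisFun (K.vfield v) (Fin n)),
      Module.Basis.toMatrix_mul_toMatrix_flip _ _, Module.Basis.toMatrix_mul_toMatrix_flip _ _⟩, rfl⟩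
  refine ⟨fun v => (hunit v).unit, fun e => ?_⟩
  ext a j
  have h₁ : (1 : Matrix (Fin n) (Fin n) (K.efield e)).mulVec
      (K.ι (o.left_mem e) ∘ τ _ (1 ⊗ₜ β j)) = (g e).1.mulVec
      (K.ι (o.right_mem e) ∘ τ _ (1 ⊗ₜ β j)) := by
    have h₂ := (hcomm (o.left_mem e) (β j)).trans (hcomm (o.right_mem e) (β j)).symm
    change (if o.left e = o.left e then 1 else g e : GL (Fin n) (K.efield e)).1.mulVec _ =
      (if o.right e = o.left e then 1 else g e : GL (Fin n) (K.efield e)).1.mulVec _ at h₂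
    -- Absence of loops ensures that the right vertex carries `g e` and not the identity.
    rw [if_pos rfl, if_neg (o.left_ne_right e).symm] at h₂
    exact h₂
  rw [Matrix.one_mulVec] at h₁
  simpa [Matrix.mul_apply, Matrix.mulVec, dotProduct, H] using congrFun h₁ a

end

theorem theorem2p5 {V : Type w₁} {E : Type w₂} [Finite V] [Finite E]
    (Γ : LooplessMultigraph V E) (hΓ : Γ.Connected) (F : Type u) [Field F]
    (K : GammaOverField Γ F) (o : Γ.Orientation) :
    [ ∀ n : ℕ, 1 ≤ n → (ClosedSubgroupGL.GLn n F).IsFactorizable K o,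
      ∀ n : ℕ, 1 ≤ n → (ClosedSubgroupGL.GLn n F).IsSepFactorizable K o,
      ∀ (n : ℕ) (A : ClosedSubgroupGL n F), A.IsSmooth → A.IsSepFactorizable K o ].TFAE ∧
    (PatchingHolds K ↔
      ∀ (n : ℕ) (A : ClosedSubgroupGL n F), A.IsSmooth → A.IsSepFactorizable K o) := by
  have : Nonempty V := hΓ.nonempty
  have tfae : [ ∀ n : ℕ, 1 ≤ n → (ClosedSubgroupGL.GLn n F).IsFactorizable K o,
      ∀ n : ℕ, 1 ≤ n → (ClosedSubgroupGL.GLn n F).IsSepFactorizable K o,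
      ∀ (n : ℕ) (A : ClosedSubgroupGL n F), A.IsSmooth → A.IsSepFactorizable K o ].TFAE := by
    simp only [ClosedSubgroupGL.isFactorizable_GLn_iff, ClosedSubgroupGL.isSepFactorizable_GLn_iff]
    tfae_have 1 → 2 := fun H n _ =>
      K.glFactors_ιBase_of_isAlgebraic o (GLFactors.of_one_le H) (SeparableClosure F) n
    tfae_have 2 → 1 := fun H n hn =>
      K.glFactors_of_glFactors_ιBase o (SeparableClosure F) n (H n hn)
    tfae_have 2 → 3 := fun H n A hA => (A.isSepFactorizable_iff K o).mpr
      (A.exists_factorization_of_glFactors K o (SeparableClosure F) (GLFactors.of_one_le H) hA)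
    tfae_have 3 → 2 := fun H n _ => (ClosedSubgroupGL.isSepFactorizable_GLn_iff K o n).mp
      (H n _ (ClosedSubgroupGL.isSmooth_GLn n))
    tfae_finish
  refine ⟨tfae, Iff.trans ?_ (tfae.out 0 2)⟩
  simp only [ClosedSubgroupGL.isFactorizable_GLn_iff]
  refine ⟨fun H n _ => ?_, fun H => ?_⟩
  · have : (baseChange K).IsEquivalence := H
    exact glFactors_of_essSurj K o n
  · exact { faithful := faithful_baseChange K
            full := full_baseChange K o
            essSurj := essSurj_baseChange K o hΓ (GLFactors.of_one_le H) }
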